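/- Let $I=[0,1]$ with Lebesgue measure $\mu$. For an integer $m\ge 2$ let $f_{sf}(x)=mx \bmod 1$ be the stretch-and-fold map. For $N\ge 1$ and a permutation $\sigma\in S_N$ of $\{1,\dots,N\}$, write $\sigma$ also for the interval exchange map $\sigma(x)=x+(\sigma(j)-j)/N$ for $(j-1)/N\le x<j/N$, $1\le j\le N$. For a map $g$ of $I$ preserving $\mu$, and functions $\phi,\psi$ of bounded variation on $I$, put $$C_{\phi,\psi}(n)=\int_I \phi(g^n(x))\,\psi(x)\,d\mu(x)-\int_I\phi\,d\mu\int_I\psi\,d\mu ,$$ and define the mixing rate of $g$ as $$\tau(g)=\inf\{\tau\ge 0 : C_{\phi,\psi}(n)=O(\tau^n)\text{ as } n\to\infty \text{ for all } \phi,\psi \text{ of bounded variation}\}.$$ Let $\tau_N(f_{sf})=\max\{\tau(\sigma\circ f_{sf}) : \sigma\in S_N\}$ be the worst mixing rate. **Theorem.** Let $N>m\ge 2$ be integers and let $d=\gcd(m,N)$. Then $$\tau_N(f_{sf})=\frac{d\,\sin(m\pi/N)}{m\,\sin(d\pi/N)} .$$ -/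

import Mathlib

open MeasureTheory Filter Asymptotics

noncomputable section

/-- The `m`-fold stretch-and-fold map `x ↦ m x mod 1`. -/
def stretchFold (m : ℕ) (x : ℝ) : ℝ := Int.fract ((m : ℝ) * x)

/-- The interval exchange map of `[0,1)` attached to `σ ∈ S_N`: it translates
`[j/N, (j+1)/N)` onto `[σ(j)/N, (σ(j)+1)/N)`. The index set is `Fin N = {0, …, N-1}`, so at most
one summand is nonzero; points outside `[0,1)` are left fixed. -/
def intervalExchange (N : ℕ) (σ : Equiv.Perm (Fin N)) (x : ℝ) : ℝ :=
  x + ∑ j : Fin N,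
    if (j : ℝ) / N ≤ x ∧ x < ((j : ℝ) + 1) / N then (((σ j : Fin N) : ℝ) - (j : ℝ)) / N else 0

/-- The correlation function `C_{φ,ψ}(n) = ∫ φ(gⁿ x) ψ(x) dμ - ∫ φ dμ ∫ ψ dμ`. -/
def correlation (μ : Measure ℝ) (g φ ψ : ℝ → ℝ) (n : ℕ) : ℝ :=
  (∫ x, φ (g^[n] x) * ψ x ∂μ) - (∫ x, φ x ∂μ) * ∫ x, ψ x ∂μ

/-- The mixing rate of `g` on `I = [0,1]` with respect to `μ`: the infimum of all `τ ≥ 0` such that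
`C_{φ,ψ}(n) = O(τⁿ)` as `n → ∞` for all observables `φ, ψ` of bounded variation on `I`. (Changing
observables on Lebesgue null sets does not change the correlations of a map preserving `μ`,
if `μ` is Lebesgue measure on `I`, so genuine functions of bounded variation are used in place
of classes.) -/
def mixingRate (μ : Measure ℝ) (g : ℝ → ℝ) : ℝ :=
  sInf {τ : ℝ | 0 ≤ τ ∧ ∀ φ ψ : ℝ → ℝ,
    BoundedVariationOn φ (Set.Icc 0 1) → BoundedVariationOn ψ (Set.Icc 0 1) →
      correlation μ g φ ψ =O[atTop] fun n : ℕ => τ ^ n}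

/-- The worst mixing rate `τ_N(f) = max {τ(σ ∘ f) : σ ∈ S_N}`, with respect to Lebesgue
measure on `I = [0,1]`. -/
def worstMixingRate (N : ℕ) (f : ℝ → ℝ) : ℝ :=
  (Finset.univ : Finset (Equiv.Perm (Fin N))).sup' Finset.univ_nonempty fun σ =>
    mixingRate (volume.restrict (Set.Icc (0 : ℝ) 1)) (intervalExchange N σ ∘ f)

end

/-! Correlations of g = σ ∘ f are integrals ∫ φ · Pⁿψ, where P is the `transfer` operator and ψ has
its mean removed. Each inverse branch of g carries a cell of length 1/N into one cell of length
1/(Nm). So P preserves functions constant on cells, and the variation inside cells shrinks by 1/m at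
each step (`cellVariation_transfer_le`).

On step values P acts by `stepTransfer` followed by a permutation, and a permutation is an ℓ²
isometry. The adjoint of `stepTransfer` is t ↦ m⁻¹ ∑_{l<m} t(im + l). With d = gcd(m, N), m = dm', N
= dn, it reduces to sliding sums on ℤ/n, which the Fourier transform diagonalises. The multipliers
are Dirichlet kernels, and away from frequency 0 the largest is at frequency 1. This gives the norm
bound `foldRate` on sum-zero vectors (`sum_sq_stepTransfer_le`) for every σ. Since 1/m ≤ `foldRate`,
the oscillation inside cells costs at most a factor linear in n, whence `mixingRate_le_foldRate`.

For the lower bound, σ is chosen so that a character j ↦ ω^(m'j), with ω = exp(2πi/n), is an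
eigenvector of the adjoint of P on step values. Its eigenvalue z = (1/m') ∑_{k<m'} ω^k has modulus
`foldRate`, and step observables have correlations Re zⁿ/N and Im zⁿ/N (`norm_le_of_eigenvector`).
-/

/-! ### Trigonometric bounds for the Dirichlet kernel -/

theorem sin_nat_mul_mul_sin_le {θ x : ℝ} (hθ : 0 < θ) (hx : θ ≤ x) (m : ℕ)
    (hm : m * x ≤ Real.pi) :
    Real.sin (m * x) * Real.sin θ ≤ Real.sin (m * θ) * Real.sin x := by
  induction m with
  | zero => simp
  | succ m ih =>
    rcases Nat.eq_zero_or_pos m with rfl | hm0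
    · simp [mul_comm]
    have hm1 : (1 : ℝ) ≤ m := by exact_mod_cast hm0
    push_cast at hm ⊢
    have ih := ih (by nlinarith)
    have hx2 : x ≤ Real.pi / 2 := by nlinarith
    have hsx : 0 ≤ Real.sin x := Real.sin_nonneg_of_nonneg_of_le_pi (by linarith) (by linarith)
    have hsθ : 0 ≤ Real.sin θ := Real.sin_nonneg_of_nonneg_of_le_pi (by linarith) (by linarith)
    have hcx : 0 ≤ Real.cos x := Real.cos_nonneg_of_mem_Icc ⟨by linarith, hx2⟩
    have hc : Real.cos x ≤ Real.cos θ :=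
      Real.cos_le_cos_of_nonneg_of_le_pi hθ.le (by linarith) hx
    have hcm : Real.cos (m * x) ≤ Real.cos (m * θ) :=
      Real.cos_le_cos_of_nonneg_of_le_pi (by positivity) (by nlinarith) (by nlinarith)
    have hsm : 0 ≤ Real.sin (m * θ) :=
      Real.sin_nonneg_of_nonneg_of_le_pi (by positivity) (by nlinarith)
    -- After the addition formula the two terms compare separately: the induction hypothesis and cos
    -- x ≤ cos θ handle the first, cos(mx) ≤ cos(mθ) the second.
    rw [add_mul, add_mul, one_mul, one_mul, Real.sin_add, Real.sin_add]
    have h1 := mul_le_mul_of_nonneg_left ih hcx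
    have h2 := mul_le_mul_of_nonneg_right hc (mul_nonneg hsm hsx)
    have h3 := mul_le_mul_of_nonneg_right hcm (mul_nonneg hsx hsθ)
    nlinarith

theorem abs_sin_nat_mul_mul_sin_le_of_le_pi_div_two {θ x : ℝ} (hθ : 0 < θ) (hx : θ ≤ x)
    (hx2 : x ≤ Real.pi / 2) (m : ℕ) (hm : m * θ ≤ Real.pi / 2) :
    |Real.sin (m * x)| * Real.sin θ ≤ Real.sin (m * θ) * Real.sin x := by
  have hpi := Real.pi_pos
  rcases Nat.eq_zero_or_pos m with rfl | hm0
  · simp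
  have hm1 : (1 : ℝ) ≤ m := by exact_mod_cast hm0
  have hsx : 0 ≤ Real.sin x := Real.sin_nonneg_of_nonneg_of_le_pi (by linarith) (by linarith)
  have hsθ : 0 ≤ Real.sin θ := Real.sin_nonneg_of_nonneg_of_le_pi (by linarith) (by linarith)
  have hsm : 0 ≤ Real.sin (m * θ) :=
    Real.sin_nonneg_of_nonneg_of_le_pi (by positivity) (by linarith)
  by_cases h : m * x ≤ Real.pi
  · rw [abs_of_nonneg (Real.sin_nonneg_of_nonneg_of_le_pi (by nlinarith) h)]
    exact sin_nat_mul_mul_sin_le hθ hx m h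
  · push Not at h
    -- Past π the numerator is bounded by 1, its value at π/(2m), while sin x only exceeds
    -- sin(π/(2m)); so the bound at π/(2m) suffices.
    have hy : m * (Real.pi / (2 * m)) = Real.pi / 2 := by field_simp
    have h1 := sin_nat_mul_mul_sin_le (x := Real.pi / (2 * m)) hθ
      (by rw [le_div_iff₀ (by positivity)]; linarith) m (by rw [hy]; linarith)
    rw [hy, Real.sin_pi_div_two, one_mul] at h1
    have h2 : Real.sin (Real.pi / (2 * m)) ≤ Real.sin x := by
      apply Real.sin_le_sin_of_le_of_le_pi_div_two _ hx2
      · rw [div_le_iff₀ (by positivity)]; nlinarith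
      · have : 0 ≤ Real.pi / (2 * m) := by positivity
        linarith
    calc |Real.sin (m * x)| * Real.sin θ ≤ 1 * Real.sin θ :=
          mul_le_mul_of_nonneg_right (Real.abs_sin_le_one _) hsθ
      _ ≤ Real.sin (m * θ) * Real.sin (Real.pi / (2 * m)) := by simpa using h1
      _ ≤ _ := mul_le_mul_of_nonneg_left h2 hsm

/-- At multiples of `π / n` the Dirichlet kernel is largest at `π / n` itself. -/
theorem abs_sin_mul_mul_sin_le {n m l : ℕ} (hm : m < n) (hl : 0 < l) (hln : l < n) :
    |Real.sin (m * (l * Real.pi / n))| * Real.sin (Real.pi / n) ≤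
      Real.sin (m * (Real.pi / n)) * Real.sin (l * Real.pi / n) := by
  have hpi := Real.pi_pos
  have hn : (0 : ℝ) < n := by exact_mod_cast (by omega : 0 < n)
  -- The reflections m ↦ n - m and l ↦ n - l change the sines only by signs, so it is enough to
  -- treat both in the lower half.
  have key : ∀ m l : ℕ, 0 < l → 2 * m ≤ n → 2 * l ≤ n →
      |Real.sin (m * (l * Real.pi / n))| * Real.sin (Real.pi / n) ≤
      Real.sin (m * (Real.pi / n)) * Real.sin (l * Real.pi / n) := by
    intro m l hl hm hln
    have hl' : (1 : ℝ) ≤ l := by exact_mod_cast hl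
    have hm' : (2 : ℝ) * m ≤ n := by exact_mod_cast hm
    have hln' : (2 : ℝ) * l ≤ n := by exact_mod_cast hln
    apply abs_sin_nat_mul_mul_sin_le_of_le_pi_div_two (by positivity)
    · gcongr; nlinarith
    · rw [div_le_div_iff₀ hn (by norm_num)]; nlinarith
    · rw [← mul_div_assoc, div_le_div_iff₀ hn (by norm_num)]; nlinarith
  have key2 : ∀ l : ℕ, 0 < l → 2 * l ≤ n →
      |Real.sin (m * (l * Real.pi / n))| * Real.sin (Real.pi / n) ≤
      Real.sin (m * (Real.pi / n)) * Real.sin (l * Real.pi / n) := by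
    intro l hl hln
    by_cases h : 2 * m ≤ n
    · exact key m l hl h hln
    have := key (n - m) l hl (by omega) hln
    rw [Nat.cast_sub hm.le] at this
    have e1 : ((n : ℝ) - m) * (l * Real.pi / n) = l * Real.pi - m * (l * Real.pi / n) := by
      field_simp
    have e2 : ((n : ℝ) - m) * (Real.pi / n) = Real.pi - m * (Real.pi / n) := by
      field_simp
    rwa [e1, e2, Real.sin_pi_sub, Real.sin_nat_mul_pi_sub, abs_neg, abs_mul, abs_pow, abs_neg,
      abs_one, one_pow, one_mul] at this
  by_cases h : 2 * l ≤ n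
  · exact key2 l hl h
  have := key2 (n - l) (by omega) (by omega)
  rw [Nat.cast_sub hln.le] at this
  have e1 : m * (((n : ℝ) - l) * Real.pi / n) = m * Real.pi - m * (l * Real.pi / n) := by
    field_simp
  have e2 : ((n : ℝ) - l) * Real.pi / n = Real.pi - l * Real.pi / n := by
    field_simp
  rwa [e1, e2, Real.sin_pi_sub, Real.sin_nat_mul_pi_sub, abs_neg, abs_mul, abs_pow, abs_neg,
      abs_one, one_pow, one_mul] at this

/-- Follows from |exp(2iy) - 1| = 2|sin y|, applied to both ends of the geometric sum formula. -/
theorem norm_geom_sum_exp_mul_abs_sin (x : ℝ) (m : ℕ) :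
    ‖∑ k ∈ Finset.range m, Complex.exp (Complex.I * (2 * x : ℝ)) ^ k‖ * |Real.sin x| =
      |Real.sin (m * x)| := by
  have h := congrArg norm (geom_sum_mul (Complex.exp (Complex.I * (2 * x : ℝ))) m)
  rw [← Complex.exp_nat_mul, show (m : ℂ) * (Complex.I * (2 * x : ℝ)) =
    Complex.I * ((2 * (m * x) : ℝ) : ℂ) by push_cast; ring, norm_mul,
    Complex.norm_exp_I_mul_ofReal_sub_one, Complex.norm_exp_I_mul_ofReal_sub_one,
    mul_div_cancel_left₀ _ two_ne_zero, mul_div_cancel_left₀ _ two_ne_zero, norm_mul, norm_mul,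
    Real.norm_eq_abs, Real.norm_eq_abs, Real.norm_eq_abs, abs_two] at h
  linarith

/-! ### Fourier analysis of sliding sums on ℤ/n -/

namespace ZMod

open scoped ZMod ComplexConjugate

variable {n : ℕ} [NeZero n]

/-- Parseval's identity, obtained from the inversion formula `dft_dft`. -/
theorem sum_norm_sq_dft (T : ZMod n → ℂ) :
    ∑ k, ‖𝓕 T k‖ ^ 2 = n * ∑ j, ‖T j‖ ^ 2 := by
  have hc : ∀ k, conj (𝓕 T k) = ∑ j, stdAddChar (j * k) * conj (T j) := by
    intro k
    rw [dft_apply, map_sum]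
    refine Finset.sum_congr rfl fun j _ => ?_
    rw [smul_eq_mul, map_mul, ← AddChar.map_neg_eq_conj, neg_neg]
  have hd : ∀ j, ∑ k, stdAddChar (j * k) * 𝓕 T k = n * T j := by
    intro j
    have := congrFun (dft_dft T) (-j)
    rw [dft_apply] at this
    simpa [mul_comm j] using this
  have : ((∑ k, ‖𝓕 T k‖ ^ 2 : ℝ) : ℂ) = ((n * ∑ j, ‖T j‖ ^ 2 : ℝ) : ℂ) := by
    push_cast
    calc ∑ k, (‖𝓕 T k‖ : ℂ) ^ 2 = ∑ k, ∑ j, conj (T j) * (stdAddChar (j * k) * 𝓕 T k) := by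
          refine Finset.sum_congr rfl fun k _ => ?_
          rw [← Complex.conj_mul', hc, Finset.sum_mul]
          exact Finset.sum_congr rfl fun j _ => by ring
      _ = ∑ j, conj (T j) * ∑ k, stdAddChar (j * k) * 𝓕 T k := by
          rw [Finset.sum_comm]; simp_rw [Finset.mul_sum]
      _ = _ := by
          rw [Finset.mul_sum]
          refine Finset.sum_congr rfl fun j _ => ?_
          rw [hd, ← Complex.conj_mul']; ring
  exact_mod_cast this

/-- A sliding sum is a sum of translates, and a translate by k multiplies the transform by the k-th
power of the character value. -/
theorem dft_sliding_sum (T : ZMod n → ℂ) (m : ℕ) (l : ZMod n) :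
    𝓕 (fun j : ZMod n => ∑ k ∈ Finset.range m, T (j + (k : ZMod n))) l =
      (∑ k ∈ Finset.range m, stdAddChar l ^ k) * 𝓕 T l := by
  simp only [dft_apply, smul_eq_mul, Finset.mul_sum, Finset.sum_mul]
  rw [Finset.sum_comm]
  simp_rw [Finset.sum_comm (s := (Finset.univ : Finset (ZMod n)))]
  refine Finset.sum_congr rfl fun k _ => ?_
  rw [← Equiv.sum_comp (Equiv.addRight (-(k : ZMod n)))]
  refine Finset.sum_congr rfl fun j _ => ?_
  rw [Equiv.coe_addRight, neg_add_cancel_right, ← AddChar.map_nsmul_eq_pow, ← mul_assoc,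
    ← AddChar.map_add_eq_mul]
  congr 2
  rw [nsmul_eq_mul]; ring

theorem norm_geom_sum_stdAddChar_le {m : ℕ} (hm : m < n) {l : ZMod n} (hl : l ≠ 0) :
    ‖∑ k ∈ Finset.range m, (stdAddChar l : ℂ) ^ k‖ ≤
      Real.sin (m * (Real.pi / n)) / Real.sin (Real.pi / n) := by
  have hpi := Real.pi_pos
  have hl0 : 0 < l.val := Nat.pos_of_ne_zero (by simpa using hl)
  have hln : l.val < n := ZMod.val_lt l
  have hn : (0 : ℝ) < n := by exact_mod_cast (by omega : 0 < n)
  have hl1 : (1 : ℝ) ≤ l.val := by exact_mod_cast hl0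
  have hl2 : (l.val : ℝ) < n := by exact_mod_cast hln
  have he : (stdAddChar l : ℂ) = Complex.exp (Complex.I * (2 * (l.val * Real.pi / n) : ℝ)) := by
    have := stdAddChar_coe (N := n) (l.val : ℤ)
    rw [Int.cast_natCast, ZMod.natCast_zmod_val] at this
    rw [this]; congr 1; push_cast; ring
  have hs1 : 0 < Real.sin (Real.pi / n) := by
    apply Real.sin_pos_of_pos_of_lt_pi (by positivity)
    rw [div_lt_iff₀ hn]; nlinarith
  have hs2 : 0 < Real.sin (l.val * Real.pi / n) := by
    apply Real.sin_pos_of_pos_of_lt_pi (by positivity)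
    rw [div_lt_iff₀ hn]; nlinarith
  have h1 := norm_geom_sum_exp_mul_abs_sin (l.val * Real.pi / n) m
  rw [← he, abs_of_pos hs2] at h1
  have h2 := abs_sin_mul_mul_sin_le hm hl0 hln
  rw [← h1] at h2
  rw [le_div_iff₀ hs1]
  nlinarith

/-- By Parseval the norm is governed by the largest multiplier; `hT` removes frequency 0, where the
multiplier would be m. -/
theorem sum_norm_sq_sliding_sum_le {m : ℕ} (hm : m < n) (T : ZMod n → ℂ) (hT : ∑ j, T j = 0) :
    ∑ j, ‖∑ k ∈ Finset.range m, T (j + k)‖ ^ 2 ≤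
      (Real.sin (m * (Real.pi / n)) / Real.sin (Real.pi / n)) ^ 2 * ∑ j, ‖T j‖ ^ 2 := by
  have hn : (0 : ℝ) < n := by exact_mod_cast (by omega : 0 < n)
  refine le_of_mul_le_mul_left ?_ hn
  rw [← sum_norm_sq_dft, mul_left_comm, ← sum_norm_sq_dft, Finset.mul_sum]
  refine Finset.sum_le_sum fun l _ => ?_
  rw [dft_sliding_sum, norm_mul, mul_pow]
  by_cases hl : l = 0
  · rw [hl, dft_apply_zero, hT]; simp
  · gcongr
    exact norm_geom_sum_stdAddChar_le hm hl

end ZMod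

/-! ### From sliding sums to strided sums -/

theorem sum_range_mul_eq {M : Type*} [AddCommMonoid M] (a b : ℕ) (F : ℕ → M) :
    ∑ j ∈ Finset.range (a * b), F j =
      ∑ i ∈ Finset.range a, ∑ l ∈ Finset.range b, F (i * b + l) := by
  induction a with
  | zero => simp
  | succ a ih => rw [Nat.succ_mul, Finset.sum_range_add, ih, Finset.sum_range_succ]

theorem sum_range_natCast_zmod {M : Type*} [AddCommMonoid M] (n : ℕ) [NeZero n]
    (F : ZMod n → M) : ∑ j ∈ Finset.range n, F j = ∑ z, F z := by
  refine Finset.sum_bij' (fun j _ => (j : ZMod n)) (fun z _ => z.val) ?_ ?_ ?_ ?_ ?_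
  · simp
  · intro z _; simpa using ZMod.val_lt z
  · intro j hj; exact ZMod.val_cast_of_lt (by simpa using hj)
  · intro z _; exact ZMod.natCast_zmod_val z
  · simp

/-- Multiplication by m permutes ℤ/n, so the starting points im run once through all residues and
the strided sums are the sliding sums reordered. -/
theorem sum_sq_strided_sum_le_of_coprime {n m : ℕ} (hmn : m < n) (hco : m.Coprime n) {T : ℕ → ℝ}
    (hper : Function.Periodic T n) (hT : ∑ j ∈ Finset.range n, T j = 0) :
    ∑ i ∈ Finset.range n, (∑ k ∈ Finset.range m, T (i * m + k)) ^ 2 ≤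
      (Real.sin (m * (Real.pi / n)) / Real.sin (Real.pi / n)) ^ 2 *
        ∑ i ∈ Finset.range n, T i ^ 2 := by
  have : NeZero n := ⟨by omega⟩
  set T' : ZMod n → ℂ := fun z => (T z.val : ℂ) with hT'
  have hcast : ∀ j : ℕ, T' (j : ZMod n) = T j := by
    intro j
    rw [hT']
    simp only [ZMod.val_natCast, hper.map_mod_nat]
  have h0 : ∑ z, T' z = 0 := by
    rw [← sum_range_natCast_zmod n T']
    simp_rw [hcast]
    exact_mod_cast hT
  have key := ZMod.sum_norm_sq_sliding_sum_le hmn T' h0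
  rw [← sum_range_natCast_zmod n (fun z => ‖T' z‖ ^ 2)] at key
  simp_rw [hcast, Complex.norm_real, Real.norm_eq_abs, sq_abs] at key
  refine le_trans (le_of_eq ?_) key
  rw [← Equiv.sum_comp (Units.mulRight (ZMod.unitOfCoprime m hco)),
    ← sum_range_natCast_zmod n (fun z => _)]
  refine Finset.sum_congr rfl fun i _ => ?_
  have : ∀ k : ℕ, T' ((Units.mulRight (ZMod.unitOfCoprime m hco)) (i : ZMod n) + (k : ZMod n)) =
      T (i * m + k) := by
    intro k
    rw [← hcast]
    simp
  simp_rw [this]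
  rw [← Complex.ofReal_sum, Complex.norm_real, Real.norm_eq_abs, sq_abs]

/-- The value of the worst mixing rate: the norm, on sum-zero vectors, of the averaging operator
`t ↦ (i ↦ m⁻¹ ∑_{l < m} t (i m + l))` on `ℤ / N`. -/
noncomputable def foldRate (m N : ℕ) : ℝ :=
  ((Nat.gcd m N : ℕ) : ℝ) * Real.sin ((m : ℝ) * Real.pi / N) /
        ((m : ℝ) * Real.sin (((Nat.gcd m N : ℕ) : ℝ) * Real.pi / N))

theorem foldRate_mul_eq {d m n : ℕ} (hd : 0 < d) (hco : m.Coprime n) :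
    foldRate (d * m) (d * n) =
      Real.sin (m * (Real.pi / n)) / Real.sin (Real.pi / n) / m := by
  have hd' : (d : ℝ) ≠ 0 := by exact_mod_cast hd.ne'
  rw [foldRate, Nat.gcd_mul_left, hco.gcd_eq_one, mul_one]
  push_cast
  rw [mul_assoc, mul_div_mul_left _ _ hd', mul_div_mul_left _ _ hd', mul_assoc,
    mul_div_mul_left _ _ hd', div_div, mul_comm (Real.sin (Real.pi / n)), mul_div_assoc (m : ℝ)]

theorem exists_gcd_decomposition {m N : ℕ} (hm : 0 < m) (hN : m < N) :
    ∃ d m' n : ℕ, 0 < d ∧ 0 < m' ∧ m' < n ∧ m'.Coprime n ∧ m = d * m' ∧ N = d * n := by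
  have hd : 0 < Nat.gcd m N := Nat.gcd_pos_of_pos_left _ hm
  have h1 := Nat.mul_div_cancel' (Nat.gcd_dvd_left m N)
  have h2 := Nat.mul_div_cancel' (Nat.gcd_dvd_right m N)
  refine ⟨Nat.gcd m N, m / Nat.gcd m N, N / Nat.gcd m N, hd, ?_, ?_,
    Nat.coprime_div_gcd_div_gcd hd, h1.symm, h2.symm⟩
  · exact Nat.div_pos (Nat.gcd_le_left _ hm) hd
  · exact Nat.div_lt_div_of_lt_of_dvd (Nat.gcd_dvd_right m N) hN

/-- Ensures that the oscillation inside cells, of order m⁻ⁿ, never dominates. It holds because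
sin(π/n) ≤ sin(m'π/n) for 1 ≤ m' < n. -/
theorem inv_le_foldRate {m N : ℕ} (hm : 0 < m) (hN : m < N) :
    (m : ℝ)⁻¹ ≤ foldRate m N := by
  have hpi := Real.pi_pos
  obtain ⟨d, m', n, hd, hm', hmn, hco, rfl, rfl⟩ := exists_gcd_decomposition hm hN
  rw [foldRate_mul_eq hd hco]
  have hn : (0 : ℝ) < n := by exact_mod_cast (by omega : 0 < n)
  have hd1 : (1 : ℝ) ≤ d := by exact_mod_cast hd
  have hm1 : (1 : ℝ) ≤ m' := by exact_mod_cast hm'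
  have hmn1 : (m' : ℝ) + 1 ≤ n := by exact_mod_cast hmn
  have hs : 0 < Real.sin (Real.pi / n) := by
    apply Real.sin_pos_of_pos_of_lt_pi (by positivity)
    rw [div_lt_iff₀ hn]; nlinarith
  have hle : Real.sin (Real.pi / n) ≤ Real.sin (m' * (Real.pi / n)) := by
    have h0 : 0 < Real.pi / n := by positivity
    have h1 : (n : ℝ) * (Real.pi / n) = Real.pi := by field_simp
    by_cases h : m' * (Real.pi / n) ≤ Real.pi / 2
    · exact Real.sin_le_sin_of_le_of_le_pi_div_two (by linarith) h (by nlinarith)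
    · rw [← Real.sin_pi_sub (m' * (Real.pi / n))]
      exact Real.sin_le_sin_of_le_of_le_pi_div_two (by linarith) (by linarith) (by nlinarith)
  calc ((d * m' : ℕ) : ℝ)⁻¹ ≤ (m' : ℝ)⁻¹ := by
        push_cast; apply inv_anti₀ (by positivity); nlinarith
    _ = 1 / m' := by rw [one_div]
    _ ≤ _ := by
        gcongr
        rwa [one_le_div₀ hs]

theorem foldRate_pos {m N : ℕ} (hm : 0 < m) (hN : m < N) : 0 < foldRate m N :=
  lt_of_lt_of_le (by positivity) (inv_le_foldRate hm hN)

/-- The strided sums see only the block sums `T` over d consecutive indices, which are n-periodic.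
Cauchy–Schwarz in a block costs a factor d, and the N = dn rows repeat d times; the resulting d² is
(m/m')². -/
theorem sum_sq_strided_sum_le {m N : ℕ} (hm : 0 < m) (hN : m < N) {t : ℕ → ℝ}
    (hper : Function.Periodic t N) (ht : ∑ j ∈ Finset.range N, t j = 0) :
    ∑ i ∈ Finset.range N, (∑ l ∈ Finset.range m, t (i * m + l)) ^ 2 ≤
      (m * foldRate m N) ^ 2 * ∑ i ∈ Finset.range N, t i ^ 2 := by
  obtain ⟨d, m', n, hd, hm', hmn, hco, rfl, rfl⟩ := exists_gcd_decomposition hm hN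
  have hm1 : (m' : ℝ) ≠ 0 := by exact_mod_cast hm'.ne'
  rw [foldRate_mul_eq hd hco]
  set κ := Real.sin (m' * (Real.pi / n)) / Real.sin (Real.pi / n)
  set T : ℕ → ℝ := fun b => ∑ r ∈ Finset.range d, t (b * d + r) with hT
  have hTper : Function.Periodic T n := by
    intro b
    refine Finset.sum_congr rfl fun r _ => ?_
    rw [show (b + n) * d + r = b * d + r + d * n by ring, hper]
  have hT0 : ∑ b ∈ Finset.range n, T b = 0 := by
    rw [← ht, mul_comm d n, sum_range_mul_eq]
  have hin : ∀ i, ∑ l ∈ Finset.range (d * m'), t (i * (d * m') + l) =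
      ∑ k ∈ Finset.range m', T (i * m' + k) := by
    intro i
    rw [mul_comm d m', sum_range_mul_eq]
    refine Finset.sum_congr rfl fun k _ => Finset.sum_congr rfl fun r _ => ?_
    congr 1; ring
  have hTsq : ∑ b ∈ Finset.range n, T b ^ 2 ≤ d * ∑ i ∈ Finset.range (d * n), t i ^ 2 := by
    rw [mul_comm d n, sum_range_mul_eq, Finset.mul_sum]
    refine Finset.sum_le_sum fun b _ => ?_
    simpa using sq_sum_le_card_mul_sum_sq (s := Finset.range d) (f := fun r => t (b * d + r))
  simp_rw [hin]
  rw [sum_range_mul_eq]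
  have hrow : ∀ i, ∑ l ∈ Finset.range n, (∑ k ∈ Finset.range m', T ((i * n + l) * m' + k)) ^ 2 =
      ∑ l ∈ Finset.range n, (∑ k ∈ Finset.range m', T (l * m' + k)) ^ 2 := by
    intro i
    refine Finset.sum_congr rfl fun l _ => ?_
    congr 1
    refine Finset.sum_congr rfl fun k _ => ?_
    rw [show (i * n + l) * m' + k = l * m' + k + (i * m') * n by ring]
    exact hTper.nat_mul (i * m') _
  simp_rw [hrow]
  rw [Finset.sum_const, Finset.card_range, nsmul_eq_mul]
  calc (d : ℝ) * ∑ l ∈ Finset.range n, (∑ k ∈ Finset.range m', T (l * m' + k)) ^ 2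
      ≤ d * (κ ^ 2 * (d * ∑ i ∈ Finset.range (d * n), t i ^ 2)) := by
        gcongr
        exact (sum_sq_strided_sum_le_of_coprime hmn hco hTper hT0).trans
          (mul_le_mul_of_nonneg_left hTsq (sq_nonneg _))
    _ = _ := by
        push_cast
        rw [mul_assoc (d : ℝ) m', mul_div_cancel₀ κ hm1]; ring

/-! ### The transfer operator on step values -/

/-- The action of the transfer operator of the stretch-and-fold map on step functions. -/
noncomputable def stepTransfer (m N : ℕ) (s : ℕ → ℝ) (i : ℕ) : ℝ :=
  (∑ k ∈ Finset.range m, s ((i + k * N) / m)) / m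

/-- Both sides are m⁻¹ ∑_{j<mN} t(j) s(⌊j/m⌋), with j written as kN + i on one side and as im + l on
the other. -/
theorem sum_mul_stepTransfer {m N : ℕ} (hm : 0 < m) (s : ℕ → ℝ) {t : ℕ → ℝ}
    (hper : Function.Periodic t N) :
    ∑ i ∈ Finset.range N, t i * stepTransfer m N s i =
      ∑ i ∈ Finset.range N, ((∑ l ∈ Finset.range m, t (i * m + l)) / m) * s i := by
  have h1 : ∑ j ∈ Finset.range (m * N), t j * s (j / m) =
      ∑ i ∈ Finset.range N, t i * ∑ k ∈ Finset.range m, s ((i + k * N) / m) := by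
    rw [sum_range_mul_eq, Finset.sum_comm]
    refine Finset.sum_congr rfl fun i _ => ?_
    rw [Finset.mul_sum]
    refine Finset.sum_congr rfl fun k _ => ?_
    rw [add_comm (k * N) i]
    congr 1
    exact hper.nat_mul k i
  have h2 : ∑ j ∈ Finset.range (m * N), t j * s (j / m) =
      ∑ i ∈ Finset.range N, (∑ l ∈ Finset.range m, t (i * m + l)) * s i := by
    rw [mul_comm m N, sum_range_mul_eq]
    refine Finset.sum_congr rfl fun i _ => ?_
    rw [Finset.sum_mul]
    refine Finset.sum_congr rfl fun l hl => ?_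
    rw [mul_comm i m, Nat.mul_add_div hm, Nat.div_eq_of_lt (Finset.mem_range.1 hl), add_zero]
  simp_rw [stepTransfer, mul_div_assoc', div_mul_eq_mul_div, ← Finset.sum_div, ← h1, h2]

theorem sum_stepTransfer {m N : ℕ} (hm : 0 < m) (s : ℕ → ℝ) :
    ∑ i ∈ Finset.range N, stepTransfer m N s i = ∑ i ∈ Finset.range N, s i := by
  have hm' : (m : ℝ) ≠ 0 := by exact_mod_cast hm.ne'
  have := sum_mul_stepTransfer (N := N) hm s (t := fun _ => 1) (fun _ => rfl)
  simpa [hm'] using this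

/-- An operator B and its adjoint A have the same norm: ‖Bs‖² = ⟨ABs, s⟩ ≤ ‖ABs‖‖s‖, and the bound
for A applies because Bs again has sum zero. -/
theorem sum_sq_stepTransfer_le {m N : ℕ} (hm : 0 < m) (hN : m < N) {s : ℕ → ℝ}
    (hs : ∑ i ∈ Finset.range N, s i = 0) :
    ∑ i ∈ Finset.range N, stepTransfer m N s i ^ 2 ≤
      foldRate m N ^ 2 * ∑ i ∈ Finset.range N, s i ^ 2 := by
  have hm' : (m : ℝ) ≠ 0 := by exact_mod_cast hm.ne'
  set t : ℕ → ℝ := fun i => stepTransfer m N s (i % N) with ht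
  have hper : Function.Periodic t N := fun i => by simp [ht]
  have hti : ∀ i ∈ Finset.range N, t i = stepTransfer m N s i := fun i hi => by
    simp [ht, Nat.mod_eq_of_lt (Finset.mem_range.1 hi)]
  have ht0 : ∑ i ∈ Finset.range N, t i = 0 := by
    rw [Finset.sum_congr rfl hti, sum_stepTransfer hm, hs]
  have hA := sum_sq_strided_sum_le hm hN hper ht0
  have hX : ∑ i ∈ Finset.range N, stepTransfer m N s i ^ 2 =
      ∑ i ∈ Finset.range N, ((∑ l ∈ Finset.range m, t (i * m + l)) / m) * s i := by
    rw [← sum_mul_stepTransfer hm s hper]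
    exact Finset.sum_congr rfl fun i hi => by rw [hti i hi, sq]
  have hX2 : ∑ i ∈ Finset.range N, t i ^ 2 = ∑ i ∈ Finset.range N, stepTransfer m N s i ^ 2 :=
    Finset.sum_congr rfl fun i hi => by rw [hti i hi]
  have hCS := Finset.sum_mul_sq_le_sq_mul_sq (Finset.range N)
    (fun i => (∑ l ∈ Finset.range m, t (i * m + l)) / m) s
  rw [← hX] at hCS
  rw [hX2] at hA
  simp_rw [div_pow, ← Finset.sum_div] at hCS
  set X := ∑ i ∈ Finset.range N, stepTransfer m N s i ^ 2
  have hS : 0 ≤ ∑ i ∈ Finset.range N, s i ^ 2 := Finset.sum_nonneg fun i _ => sq_nonneg _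
  have hX0 : 0 ≤ X := Finset.sum_nonneg fun i _ => sq_nonneg _
  have hA' : (∑ i ∈ Finset.range N, (∑ l ∈ Finset.range m, t (i * m + l)) ^ 2) / (m : ℝ) ^ 2 ≤
      foldRate m N ^ 2 * X := by
    rw [div_le_iff₀ (by positivity)]; linarith [hA]
  have h := hCS.trans (mul_le_mul_of_nonneg_right hA' hS)
  rcases hX0.eq_or_lt with h0 | h0
  · rw [← h0]; positivity
  · refine le_of_mul_le_mul_left ?_ h0
    linarith

/-- The first `N` terms of a sequence, as a Euclidean vector. -/
noncomputable def euclideanVec (N : ℕ) (s : ℕ → ℝ) : EuclideanSpace ℝ (Fin N) :=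
  WithLp.toLp 2 fun i => s i

theorem norm_toLp_le_of_forall_abs_le {N : ℕ} {r : Fin N → ℝ} {c : ℝ} (hr : ∀ i, |r i| ≤ c)
    (hc : 0 ≤ c) : ‖(WithLp.toLp 2 r : EuclideanSpace ℝ (Fin N))‖ ≤ N * c := by
  rw [EuclideanSpace.norm_eq]
  apply Real.sqrt_le_iff.2 ⟨by positivity, ?_⟩
  calc ∑ i, ‖r i‖ ^ 2 ≤ ∑ _i : Fin N, c ^ 2 := by
        refine Finset.sum_le_sum fun i _ => ?_
        exact pow_le_pow_left₀ (norm_nonneg _) (hr i) 2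
    _ = N * c ^ 2 := by simp
    _ ≤ _ := by
        rw [mul_pow]
        gcongr
        exact_mod_cast Nat.le_self_pow two_ne_zero N

/-- The contraction is available only for sum-zero vectors, so the mean `a` is subtracted. One V
pays for this mean, the other for the deviation of `s'` from the exact step action. -/
theorem norm_euclideanVec_le {m N : ℕ} (hm : 0 < m) (hN : m < N) (σ : Equiv.Perm (Fin N))
    {s s' : ℕ → ℝ} {V : ℝ} (hV : ∀ i : Fin N, |s' i - stepTransfer m N s (σ i)| ≤ V)
    (hs : |∑ i ∈ Finset.range N, s i| ≤ N * V) :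
    ‖euclideanVec N s'‖ ≤ foldRate m N * ‖euclideanVec N s‖ + N * (2 * V) := by
  have hN0 : (0 : ℝ) < N := by exact_mod_cast (by omega : 0 < N)
  have hm0 : (m : ℝ) ≠ 0 := by exact_mod_cast hm.ne'
  have hρ := foldRate_pos hm hN
  have hV0 : 0 ≤ V := nonneg_of_mul_nonneg_right ((abs_nonneg _).trans hs) hN0
  set a : ℝ := (∑ i ∈ Finset.range N, s i) / N with ha
  have haV : |a| ≤ V := by
    rw [ha, abs_div, abs_of_pos hN0, div_le_iff₀ hN0]; linarith
  set u : ℕ → ℝ := fun i => s i - a with hu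
  have hNa : N * a = ∑ i ∈ Finset.range N, s i := by rw [ha]; field_simp
  have hu0 : ∑ i ∈ Finset.range N, u i = 0 := by
    simp [hu, Finset.sum_sub_distrib, hNa]
  have hu2 : ∑ i ∈ Finset.range N, u i ^ 2 ≤ ∑ i ∈ Finset.range N, s i ^ 2 := by
    have : ∑ i ∈ Finset.range N, s i ^ 2 =
        ∑ i ∈ Finset.range N, (u i ^ 2 + (2 * a * u i + a ^ 2)) :=
      Finset.sum_congr rfl fun i _ => by simp only [hu]; ring
    rw [this, Finset.sum_add_distrib, Finset.sum_add_distrib, ← Finset.mul_sum, hu0]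
    simp; positivity
  have hBu : ∀ i, stepTransfer m N s i = stepTransfer m N u i + a := by
    intro i
    simp only [stepTransfer, hu, Finset.sum_sub_distrib, Finset.sum_const, Finset.card_range,
      nsmul_eq_mul]
    field_simp; ring
  have hdec : euclideanVec N s' = (WithLp.toLp 2 fun i : Fin N => stepTransfer m N u (σ i)) +
      (WithLp.toLp 2 fun i : Fin N => s' i - stepTransfer m N u (σ i)) := by
    ext i; simp [euclideanVec]
  rw [hdec]
  refine (norm_add_le _ _).trans (add_le_add ?_ (norm_toLp_le_of_forall_abs_le ?_ (by positivity)))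
  · rw [EuclideanSpace.norm_eq, euclideanVec, EuclideanSpace.norm_eq]
    apply Real.sqrt_le_iff.2 ⟨by positivity, ?_⟩
    rw [mul_pow, Real.sq_sqrt (by positivity)]
    simp only [Real.norm_eq_abs, sq_abs]
    rw [Equiv.sum_comp σ (fun i : Fin N => stepTransfer m N u i ^ 2),
      Fin.sum_univ_eq_sum_range (fun i => stepTransfer m N u i ^ 2),
      Fin.sum_univ_eq_sum_range (fun i => s i ^ 2)]
    exact (sum_sq_stepTransfer_le hm hN hu0).trans
      (mul_le_mul_of_nonneg_left hu2 (sq_nonneg _))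
  · intro i
    have h1 := hV i
    rw [hBu] at h1
    have : s' i - stepTransfer m N u (σ i) =
      (s' i - (stepTransfer m N u (σ i) + a)) + a := by ring
    rw [this, two_mul]
    exact (abs_add_le _ _).trans (add_le_add h1 haV)

/-- The case q = ρ is allowed, which is why a factor linear in n appears. -/
theorem le_add_mul_pow_of_recurrence {e : ℕ → ℝ} {ρ q K : ℝ} (hρ : 0 < ρ) (hq : 0 ≤ q)
    (hqρ : q ≤ ρ) (hK : 0 ≤ K) (he : ∀ n, e (n + 1) ≤ ρ * e n + K * q ^ n) (n : ℕ) :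
    e n ≤ (e 0 + n * (K / ρ)) * ρ ^ n := by
  induction n with
  | zero => simp
  | succ n ih =>
    have h1 : K * q ^ n ≤ K * ρ ^ n := by gcongr
    have h2 : K / ρ * ρ ^ (n + 1) = K * ρ ^ n := by rw [pow_succ]; field_simp
    calc e (n + 1) ≤ ρ * e n + K * q ^ n := he n
      _ ≤ ρ * ((e 0 + n * (K / ρ)) * ρ ^ n) + K * ρ ^ n := by gcongr
      _ = _ := by rw [← h2]; push_cast; ring

/-! ### Cells and the interval exchange -/

/-- The `j`-th half-open interval of length `1 / N`. -/
def cell (N j : ℕ) : Set ℝ := Set.Ico ((j : ℝ) / N) (((j : ℝ) + 1) / N)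

theorem mem_cell_iff {N : ℕ} (hN : 0 < N) {j : ℕ} {x : ℝ} :
    x ∈ cell N j ↔ (j : ℝ) ≤ N * x ∧ N * x < j + 1 := by
  have hN' : (0 : ℝ) < N := by exact_mod_cast hN
  rw [cell, Set.mem_Ico, div_le_iff₀ hN', lt_div_iff₀ hN', mul_comm x]

theorem left_mem_cell {N : ℕ} (hN : 0 < N) (j : ℕ) : (j : ℝ) / N ∈ cell N j := by
  have hN' : (0 : ℝ) < N := by exact_mod_cast hN
  rw [mem_cell_iff hN, mul_div_cancel₀ _ hN'.ne']
  simp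

theorem add_div_mem_cell {N : ℕ} (hN : 0 < N) (j : ℕ) {t : ℝ} (ht : t ∈ Set.Ico (0 : ℝ) 1) :
    (t + j) / N ∈ cell N j := by
  have hN' : (0 : ℝ) < N := by exact_mod_cast hN
  rw [mem_cell_iff hN, mul_div_cancel₀ _ hN'.ne']
  constructor <;> linarith [ht.1, ht.2]

theorem eq_of_mem_cell {N : ℕ} (hN : 0 < N) {i j : ℕ} {x : ℝ} (hi : x ∈ cell N i)
    (hj : x ∈ cell N j) : i = j := by
  rw [mem_cell_iff hN] at hi hj
  have h1 : (i : ℝ) < j + 1 := by linarith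
  have h2 : (j : ℝ) < i + 1 := by linarith
  norm_cast at h1 h2
  omega

theorem exists_mem_cell {N : ℕ} (hN : 0 < N) {x : ℝ} (hx : x ∈ Set.Ico (0 : ℝ) 1) :
    ∃ i : Fin N, x ∈ cell N i := by
  have hN' : (0 : ℝ) < N := by exact_mod_cast hN
  have h0 : 0 ≤ N * x := mul_nonneg hN'.le hx.1
  refine ⟨⟨⌊N * x⌋₊, (Nat.floor_lt h0).2 (by nlinarith [hx.2])⟩, (mem_cell_iff hN).2 ?_⟩
  exact ⟨Nat.floor_le h0, Nat.lt_floor_add_one _⟩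

theorem cell_subset_Ico {N : ℕ} {i : ℕ} (hi : i < N) :
    cell N i ⊆ Set.Ico 0 1 := by
  intro x hx
  have hN : 0 < N := by omega
  have hN' : (0 : ℝ) < N := by exact_mod_cast hN
  rw [mem_cell_iff hN] at hx
  have h1 : (i : ℝ) + 1 ≤ N := by exact_mod_cast hi
  have h2 : (0 : ℝ) ≤ i := by positivity
  constructor <;> nlinarith

theorem cell_subset_cell_div {m N : ℕ} (hm : 0 < m) (hN : 0 < N) (j : ℕ) :
    cell (N * m) j ⊆ cell N (j / m) := by
  intro x hx
  have hm' : (0 : ℝ) < m := by exact_mod_cast hm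
  rw [mem_cell_iff (Nat.mul_pos hN hm)] at hx
  rw [mem_cell_iff hN]
  have h1 : ((j / m : ℕ) : ℝ) * m ≤ j := by exact_mod_cast Nat.div_mul_le_self j m
  have h2 : (j : ℝ) + 1 ≤ (((j / m : ℕ) : ℝ) + 1) * m := by
    have e := Nat.div_add_mod j m
    have e' := Nat.mod_lt j hm
    exact_mod_cast (by nlinarith : j + 1 ≤ (j / m + 1) * m)
  push_cast at hx
  constructor
  · refine le_of_mul_le_mul_right ?_ hm'
    linarith
  · refine lt_of_mul_lt_mul_right ?_ hm'.le
    linarith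

theorem intervalExchange_of_mem_cell {N : ℕ} (σ : Equiv.Perm (Fin N)) {j : Fin N} {x : ℝ}
    (hx : x ∈ cell N j) :
    intervalExchange N σ x = x + (((σ j : Fin N) : ℝ) - (j : ℝ)) / N := by
  have hN : 0 < N := j.pos
  rw [intervalExchange, Finset.sum_eq_single j, if_pos (show _ ∧ _ from hx)]
  · intro i _ hij
    rw [if_neg]
    intro hi
    exact hij (Fin.ext (eq_of_mem_cell hN hi hx))
  · simp

theorem intervalExchange_add_div {N : ℕ} (σ : Equiv.Perm (Fin N)) (j : Fin N) {t : ℝ}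
    (ht : t ∈ Set.Ico (0 : ℝ) 1) :
    intervalExchange N σ ((t + j) / N) = (t + (σ j : Fin N)) / N := by
  rw [intervalExchange_of_mem_cell σ (add_div_mem_cell j.pos j ht)]
  ring

theorem intervalExchange_mem_cell {N : ℕ} (σ : Equiv.Perm (Fin N)) {j : Fin N} {x : ℝ}
    (hx : x ∈ cell N j) : intervalExchange N σ x ∈ cell N (σ j) := by
  have hN' : (0 : ℝ) < N := by exact_mod_cast j.pos
  rw [intervalExchange_of_mem_cell σ hx]
  rw [mem_cell_iff j.pos] at hx ⊢
  rw [mul_add, mul_div_cancel₀ _ hN'.ne']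
  constructor <;> linarith [hx.1, hx.2]

theorem measurable_intervalExchange (N : ℕ) (σ : Equiv.Perm (Fin N)) :
    Measurable (intervalExchange N σ) := by
  refine measurable_id.add (Finset.measurable_sum _ fun j _ => ?_)
  exact Measurable.ite measurableSet_Ico measurable_const measurable_const

/-! ### The transfer operator and variation inside cells -/

/-- The transfer operator of `intervalExchange N σ ∘ stretchFold m` on `[0, 1)`. -/
noncomputable def transfer (m N : ℕ) (σ : Equiv.Perm (Fin N)) (u : ℝ → ℝ) (y : ℝ) : ℝ :=
  (∑ k ∈ Finset.range m, u ((intervalExchange N σ⁻¹ y + k) / m)) / m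

theorem inverse_branch_mem_cell {m N : ℕ} (hm : 0 < m) (σ : Equiv.Perm (Fin N)) {i : Fin N}
    {y : ℝ} (hy : y ∈ cell N i) (k : ℕ) :
    (intervalExchange N σ⁻¹ y + k) / m ∈ cell (N * m) ((σ⁻¹ i : Fin N) + k * N) := by
  have hm' : (0 : ℝ) < m := by exact_mod_cast hm
  have h := intervalExchange_mem_cell σ⁻¹ hy
  rw [mem_cell_iff i.pos] at h
  rw [mem_cell_iff (Nat.mul_pos i.pos hm)]
  push_cast
  have : (N : ℝ) * m * ((intervalExchange N σ⁻¹ y + k) / m) =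
      N * intervalExchange N σ⁻¹ y + k * N := by field_simp
  rw [this]
  constructor <;> linarith [h.1, h.2]

theorem branch_index_div_lt {m N : ℕ} (i : Fin N) {k : ℕ} (hk : k < m) :
    ((i : ℕ) + k * N) / m < N := by
  have : (k + 1) * N ≤ m * N := Nat.mul_le_mul_right N hk
  rw [Nat.div_lt_iff_lt_mul (by omega)]
  have := i.isLt
  nlinarith

section variation

open scoped ENNReal NNReal

theorem eVariationOn_add_le (f g : ℝ → ℝ) (s : Set ℝ) :
    eVariationOn (fun x => f x + g x) s ≤ eVariationOn f s + eVariationOn g s := by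
  refine iSup_le fun p => ?_
  refine le_trans (Finset.sum_le_sum fun i _ => edist_add_add_le _ _ _ _) ?_
  rw [Finset.sum_add_distrib]
  exact add_le_add (eVariationOn.sum_le p.2.2.1 p.2.2.2)
    (eVariationOn.sum_le p.2.2.1 p.2.2.2)

theorem eVariationOn_sum_le {ι : Type*} (A : Finset ι) (F : ι → ℝ → ℝ) (s : Set ℝ) :
    eVariationOn (fun x => ∑ k ∈ A, F k x) s ≤ ∑ k ∈ A, eVariationOn (F k) s := by
  classical
  induction A using Finset.induction_on with
  | empty => simp [eVariationOn.constant_on (f := fun _ : ℝ => (0 : ℝ))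
      (Set.subsingleton_singleton.anti (by rintro _ ⟨_, _, rfl⟩; exact Set.mem_singleton _))]
  | insert a A ha ih =>
    simp_rw [Finset.sum_insert ha]
    exact (eVariationOn_add_le _ _ _).trans (add_le_add le_rfl ih)

theorem eVariationOn_div_natCast_le (f : ℝ → ℝ) (s : Set ℝ) (m : ℕ) :
    eVariationOn (fun x => f x / m) s ≤ ((m : ℝ≥0)⁻¹ : ℝ≥0) * eVariationOn f s := by
  have h : LipschitzWith (m : ℝ≥0)⁻¹ (fun y : ℝ => y / m) := by
    refine LipschitzWith.of_dist_le_mul fun x y => ?_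
    rw [Real.dist_eq, Real.dist_eq, ← sub_div, abs_div, Nat.abs_cast]
    simp [div_eq_inv_mul]
  exact h.lipschitzOnWith.comp_eVariationOn_le (t := Set.univ) (Set.mapsTo_univ _ _)

theorem sum_eVariationOn_Ico_le (f : ℝ → ℝ) {a : ℕ → ℝ} (ha : Monotone a) (n : ℕ) :
    ∑ l ∈ Finset.range n, eVariationOn f (Set.Ico (a l) (a (l + 1))) ≤
      eVariationOn f (Set.Ico (a 0) (a n)) := by
  induction n with
  | zero => simp
  | succ n ih =>
    rw [Finset.sum_range_succ, ← Set.Ico_union_Ico_eq_Ico (ha (Nat.zero_le n)) (ha n.le_succ)]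
    refine (add_le_add ih le_rfl).trans (eVariationOn.add_le_union f ?_)
    intro x hx y hy
    exact hx.2.le.trans hy.1

theorem sum_eVariationOn_cell_le (f : ℝ → ℝ) {m N : ℕ} (hm : 0 < m) (i : ℕ) :
    ∑ l ∈ Finset.range m, eVariationOn f (cell (N * m) (i * m + l)) ≤
      eVariationOn f (cell N i) := by
  have hm' : (m : ℝ) ≠ 0 := by exact_mod_cast hm.ne'
  have h := sum_eVariationOn_Ico_le f (a := fun l : ℕ => ((i : ℝ) * m + l) / (N * m))
    (fun p q hpq => by dsimp only; gcongr) m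
  have e1 : ((i : ℝ) * m + (0 : ℕ)) / (N * m) = i / N := by
    rw [Nat.cast_zero, add_zero, mul_div_mul_right _ _ hm']
  have e2 : ((i : ℝ) * m + m) / (N * m) = (i + 1) / N := by
    rw [← add_one_mul, mul_div_mul_right _ _ hm']
  simp only [e1, e2] at h
  refine le_trans (le_of_eq (Finset.sum_congr rfl fun l _ => ?_)) h
  rw [cell]
  push_cast
  rw [add_assoc]

/-- The total variation of a function inside the cells of length `1 / N`. -/
noncomputable def cellVariation (N : ℕ) (u : ℝ → ℝ) : ℝ≥0∞ :=
  ∑ i ∈ Finset.range N, eVariationOn u (cell N i)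

/-- As i and k vary, the inverse branches use each of the Nm small cells exactly once, so only the
averaging factor 1/m remains. Jumps between cells are not counted, hence the discontinuities of the
exchange cost nothing. -/
theorem cellVariation_transfer_le {m N : ℕ} (hm : 0 < m) (σ : Equiv.Perm (Fin N)) (u : ℝ → ℝ) :
    cellVariation N (transfer m N σ u) ≤ ((m : ℝ≥0)⁻¹ : ℝ≥0) * cellVariation N u := by
  have h1 : ∀ i : Fin N, eVariationOn (transfer m N σ u) (cell N i) ≤
      ((m : ℝ≥0)⁻¹ : ℝ≥0) *
        ∑ k ∈ Finset.range m, eVariationOn u (cell (N * m) ((σ⁻¹ i : Fin N) + k * N)) := by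
    intro i
    refine (eVariationOn_div_natCast_le _ _ m).trans ?_
    gcongr
    refine (eVariationOn_sum_le _ _ _).trans (Finset.sum_le_sum fun k _ => ?_)
    refine eVariationOn.comp_le_of_monotoneOn u _ ?_
      (fun y hy => inverse_branch_mem_cell hm σ hy k)
    intro x hx y hy hxy
    simp only [intervalExchange_of_mem_cell _ hx, intervalExchange_of_mem_cell _ hy]
    gcongr
  rw [cellVariation, cellVariation,
    ← Fin.sum_univ_eq_sum_range (fun i => eVariationOn (transfer m N σ u) (cell N i))]
  refine (Finset.sum_le_sum fun i _ => h1 i).trans ?_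
  rw [← Finset.mul_sum, Equiv.sum_comp σ⁻¹ (fun i : Fin N =>
    ∑ k ∈ Finset.range m, eVariationOn u (cell (N * m) (i + k * N))),
    Fin.sum_univ_eq_sum_range (fun i =>
      ∑ k ∈ Finset.range m, eVariationOn u (cell (N * m) (i + k * N))), Finset.sum_comm]
  gcongr
  simp_rw [add_comm _ (_ * N)]
  rw [← sum_range_mul_eq m N (fun j => eVariationOn u (cell (N * m) j)), mul_comm m N,
    sum_range_mul_eq]
  exact Finset.sum_le_sum fun i _ => sum_eVariationOn_cell_le u hm i

theorem cellVariation_iterate_transfer_le {m N : ℕ} (hm : 0 < m) (σ : Equiv.Perm (Fin N))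
    {u : ℝ → ℝ} (hu : cellVariation N u ≠ ⊤) (n : ℕ) :
    cellVariation N ((transfer m N σ)^[n] u) ≠ ⊤ ∧
      (cellVariation N ((transfer m N σ)^[n] u)).toReal ≤
        (cellVariation N u).toReal * (m : ℝ)⁻¹ ^ n := by
  induction n with
  | zero => simpa using hu
  | succ n ih =>
    rw [Function.iterate_succ_apply']
    have h := cellVariation_transfer_le hm σ ((transfer m N σ)^[n] u)
    have hfin : (((m : ℝ≥0)⁻¹ : ℝ≥0) : ℝ≥0∞) * cellVariation N ((transfer m N σ)^[n] u) ≠ ⊤ :=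
      ENNReal.mul_ne_top ENNReal.coe_ne_top ih.1
    refine ⟨ne_top_of_le_ne_top hfin h, (ENNReal.toReal_mono hfin h).trans ?_⟩
    rw [ENNReal.toReal_mul, ENNReal.coe_toReal, NNReal.coe_inv, NNReal.coe_natCast, pow_succ]
    have := mul_le_mul_of_nonneg_left ih.2 (show (0 : ℝ) ≤ (m : ℝ)⁻¹ by positivity)
    linarith

theorem abs_sub_le_cellVariation {N : ℕ} {u : ℝ → ℝ} (hu : cellVariation N u ≠ ⊤) {i : ℕ}
    (hi : i < N) {x y : ℝ} (hx : x ∈ cell N i) (hy : y ∈ cell N i) :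
    |u x - u y| ≤ (cellVariation N u).toReal := by
  have h : edist (u x) (u y) ≤ cellVariation N u :=
    (eVariationOn.edist_le u hx hy).trans (Finset.single_le_sum
      (f := fun i => eVariationOn u (cell N i)) (fun _ _ => zero_le) (Finset.mem_range.2 hi))
  rw [← Real.dist_eq, dist_edist]
  exact ENNReal.toReal_mono hu h

end variation

/-- Averaging does not enlarge the error V; V = 0 later gives the exact action on step functions. -/
theorem abs_transfer_sub_stepTransfer_le {m N : ℕ} (hm : 0 < m) (σ : Equiv.Perm (Fin N))
    {u : ℝ → ℝ} {V : ℝ} {s : ℕ → ℝ} (hs : ∀ j < N, ∀ x ∈ cell N j, |u x - s j| ≤ V) (i : Fin N)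
    {y : ℝ} (hy : y ∈ cell N i) :
    |transfer m N σ u y - stepTransfer m N s (σ⁻¹ i : Fin N)| ≤ V := by
  have hm' : (0 : ℝ) < m := by exact_mod_cast hm
  rw [transfer, stepTransfer, ← sub_div, ← Finset.sum_sub_distrib, abs_div, abs_of_pos hm',
    div_le_iff₀ hm']
  refine (Finset.abs_sum_le_sum_abs _ _).trans ?_
  refine (Finset.sum_le_card_nsmul _ _ V fun k hk => ?_).trans_eq (by simp [mul_comm])
  exact hs _ (branch_index_div_lt _ (Finset.mem_range.1 hk)) _
    (cell_subset_cell_div hm i.pos _ (inverse_branch_mem_cell hm σ hy k))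

/-! ### Integration and duality -/

theorem restrict_Icc_eq_restrict_Ico :
    (volume : Measure ℝ).restrict (Set.Icc 0 1) = volume.restrict (Set.Ico 0 1) :=
  Measure.restrict_congr_set Ico_ae_eq_Icc.symm

theorem ae_mem_Ico :
    ∀ᵐ x ∂(volume : Measure ℝ).restrict (Set.Icc 0 1), x ∈ Set.Ico (0 : ℝ) 1 := by
  rw [restrict_Icc_eq_restrict_Ico]
  exact ae_restrict_mem measurableSet_Ico

instance : IsProbabilityMeasure ((volume : Measure ℝ).restrict (Set.Icc 0 1)) :=
  ⟨by simp⟩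

/-- Bounded Borel functions. -/
def BoundedMeasurable (u : ℝ → ℝ) : Prop := Measurable u ∧ ∃ C, ∀ x, |u x| ≤ C

namespace BoundedMeasurable

theorem const (c : ℝ) : BoundedMeasurable fun _ => c :=
  ⟨measurable_const, |c|, fun _ => le_rfl⟩

theorem comp {u : ℝ → ℝ} (hu : BoundedMeasurable u) {g : ℝ → ℝ} (hg : Measurable g) :
    BoundedMeasurable fun x => u (g x) :=
  ⟨hu.1.comp hg, hu.2.imp fun _ h _ => h _⟩

theorem mul {u v : ℝ → ℝ} (hu : BoundedMeasurable u) (hv : BoundedMeasurable v) :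
    BoundedMeasurable fun x => u x * v x := by
  obtain ⟨hu, C, hC⟩ := hu
  obtain ⟨hv, D, hD⟩ := hv
  refine ⟨hu.mul hv, C * D, fun x => ?_⟩
  rw [abs_mul]
  exact mul_le_mul (hC x) (hD x) (abs_nonneg _) ((abs_nonneg _).trans (hC x))

theorem add {u v : ℝ → ℝ} (hu : BoundedMeasurable u) (hv : BoundedMeasurable v) :
    BoundedMeasurable fun x => u x + v x := by
  obtain ⟨hu, C, hC⟩ := hu
  obtain ⟨hv, D, hD⟩ := hv
  exact ⟨hu.add hv, C + D, fun x => (abs_add_le _ _).trans (add_le_add (hC x) (hD x))⟩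

theorem sum {ι : Type*} (A : Finset ι) {u : ι → ℝ → ℝ} (hu : ∀ k ∈ A, BoundedMeasurable (u k)) :
    BoundedMeasurable fun x => ∑ k ∈ A, u k x := by
  classical
  induction A using Finset.induction_on with
  | empty => simpa using const 0
  | insert a A ha ih =>
    simp_rw [Finset.sum_insert ha]
    exact (hu a (Finset.mem_insert_self a A)).add
      (ih fun k hk => hu k (Finset.mem_insert_of_mem hk))

theorem div_const {u : ℝ → ℝ} (hu : BoundedMeasurable u) (c : ℝ) :
    BoundedMeasurable fun x => u x / c := by
  simpa only [div_eq_mul_inv] using hu.mul (const c⁻¹)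

theorem integrable {u : ℝ → ℝ} (hu : BoundedMeasurable u) :
    Integrable u ((volume : Measure ℝ).restrict (Set.Icc 0 1)) := by
  obtain ⟨hu, C, hC⟩ := hu
  exact Integrable.of_bound hu.aestronglyMeasurable C (Eventually.of_forall hC)

theorem transfer {m N : ℕ} (σ : Equiv.Perm (Fin N)) {u : ℝ → ℝ} (hu : BoundedMeasurable u) :
    BoundedMeasurable (transfer m N σ u) := by
  unfold _root_.transfer
  refine div_const (sum _ fun k _ => ?_) _
  exact hu.comp (((measurable_intervalExchange N σ⁻¹).add_const (k : ℝ)).div_const (m : ℝ))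

end BoundedMeasurable

/-- Serves twice: for the m branches of the stretch-and-fold map and for the N cells of the
exchange. -/
theorem integral_eq_sum_integral_div {u : ℝ → ℝ} (hu : BoundedMeasurable u) {m : ℕ} (hm : 0 < m) :
    ∫ x, u x ∂(volume : Measure ℝ).restrict (Set.Icc 0 1) =
      ∑ k ∈ Finset.range m,
        (∫ t, u ((t + k) / m) ∂(volume : Measure ℝ).restrict (Set.Icc 0 1)) / m := by
  have hm' : (m : ℝ) ≠ 0 := by exact_mod_cast hm.ne'
  have hint : ∀ a b : ℝ, IntervalIntegrable u volume a b := by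
    intro a b
    obtain ⟨hu, C, hC⟩ := hu
    exact (intervalIntegrable_const (c := C)).mono_fun' hu.aestronglyMeasurable
      (Eventually.of_forall hC)
  have hI : ∀ v : ℝ → ℝ, ∫ x, v x ∂(volume : Measure ℝ).restrict (Set.Icc 0 1) =
      ∫ x in (0 : ℝ)..1, v x := fun v => by
    rw [intervalIntegral.integral_of_le zero_le_one, integral_Icc_eq_integral_Ioc]
  have hadj := intervalIntegral.sum_integral_adjacent_intervals (f := u) (μ := volume) (n := m)
    (a := fun k : ℕ => (k : ℝ) / m) (fun k _ => hint _ _)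
  rw [Nat.cast_zero, zero_div, div_self hm'] at hadj
  rw [hI, ← hadj]
  refine Finset.sum_congr rfl fun k _ => ?_
  rw [hI]
  have := intervalIntegral.integral_comp_div_add (a := 0) (b := 1) u hm' (k / m)
  simp_rw [← add_div] at this
  rw [this]
  simp only [smul_eq_mul, zero_add]
  rw [mul_div_cancel_left₀ _ hm', Nat.cast_succ, add_comm]

theorem stretchFold_mem_Ico (m : ℕ) (x : ℝ) : stretchFold m x ∈ Set.Ico (0 : ℝ) 1 :=
  ⟨Int.fract_nonneg _, Int.fract_lt_one _⟩

theorem stretchFold_add_div {m : ℕ} (hm : 0 < m) (k : ℕ) {t : ℝ} (ht : t ∈ Set.Ico (0 : ℝ) 1) :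
    stretchFold m ((t + k) / m) = t := by
  have hm' : (m : ℝ) ≠ 0 := by exact_mod_cast hm.ne'
  rw [stretchFold, mul_div_cancel₀ _ hm', Int.fract_add_natCast]
  exact Int.fract_eq_self.2 ht

theorem measurable_stretchFold (m : ℕ) : Measurable (stretchFold m) :=
  measurable_fract.comp (measurable_const.mul measurable_id)

theorem intervalExchange_comp_stretchFold_mem {m N : ℕ} (hN : 0 < N) (σ : Equiv.Perm (Fin N))
    (x : ℝ) : (intervalExchange N σ ∘ stretchFold m) x ∈ Set.Ico (0 : ℝ) 1 := by
  obtain ⟨i, hi⟩ := exists_mem_cell hN (stretchFold_mem_Ico m x)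
  exact cell_subset_Ico (σ i).isLt (intervalExchange_mem_cell σ hi)

theorem iterate_intervalExchange_comp_stretchFold_mem {m N : ℕ} (hN : 0 < N)
    (σ : Equiv.Perm (Fin N)) {x : ℝ} (hx : x ∈ Set.Icc (0 : ℝ) 1) (n : ℕ) :
    (intervalExchange N σ ∘ stretchFold m)^[n] x ∈ Set.Icc (0 : ℝ) 1 := by
  cases n with
  | zero => exact hx
  | succ n =>
    rw [Function.iterate_succ_apply']
    exact Set.Ico_subset_Icc_self (intervalExchange_comp_stretchFold_mem hN σ _)

theorem measurable_intervalExchange_comp_stretchFold (m N : ℕ) (σ : Equiv.Perm (Fin N)) :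
    Measurable (intervalExchange N σ ∘ stretchFold m) :=
  (measurable_intervalExchange N σ).comp (measurable_stretchFold m)

theorem integral_comp_intervalExchange_mul {N : ℕ} (hN : 0 < N) (σ : Equiv.Perm (Fin N))
    {F w : ℝ → ℝ} (hF : BoundedMeasurable F) (hw : BoundedMeasurable w) :
    ∫ t, F (intervalExchange N σ t) * w t ∂(volume : Measure ℝ).restrict (Set.Icc 0 1) =
      ∫ t, F t * w (intervalExchange N σ⁻¹ t) ∂(volume : Measure ℝ).restrict (Set.Icc 0 1) := by
  rw [integral_eq_sum_integral_div ((hF.comp (measurable_intervalExchange N σ)).mul hw) hN,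
    integral_eq_sum_integral_div (hF.mul (hw.comp (measurable_intervalExchange N σ⁻¹))) hN,
    ← Fin.sum_univ_eq_sum_range (fun k => (∫ t, F (intervalExchange N σ ((t + k) / N)) *
      w ((t + k) / N) ∂(volume : Measure ℝ).restrict (Set.Icc 0 1)) / (N : ℝ)),
    ← Fin.sum_univ_eq_sum_range (fun k => (∫ t, F ((t + k) / N) *
      w (intervalExchange N σ⁻¹ ((t + k) / N)) ∂(volume : Measure ℝ).restrict (Set.Icc 0 1)) /
      (N : ℝ)),
    ← Equiv.sum_comp σ (fun k : Fin N => (∫ t, F ((t + (k : ℕ)) / N) *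
      w (intervalExchange N σ⁻¹ ((t + (k : ℕ)) / N))
        ∂(volume : Measure ℝ).restrict (Set.Icc 0 1)) / (N : ℝ))]
  refine Finset.sum_congr rfl fun i _ => ?_
  congr 1
  refine integral_congr_ae ?_
  filter_upwards [ae_mem_Ico] with t ht
  rw [intervalExchange_add_div σ i ht, intervalExchange_add_div σ⁻¹ (σ i) ht, Equiv.Perm.inv_def,
    Equiv.symm_apply_apply]

/-- On the k-th branch x = (t + k)/m the fold returns t; the exchange is then moved to the other
factor as its inverse. -/
theorem integral_comp_mul_eq_integral_mul_transfer {m N : ℕ} (hm : 0 < m) (hN : 0 < N)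
    (σ : Equiv.Perm (Fin N)) {F u : ℝ → ℝ} (hF : BoundedMeasurable F) (hu : BoundedMeasurable u) :
    ∫ x, F ((intervalExchange N σ ∘ stretchFold m) x) * u x
        ∂(volume : Measure ℝ).restrict (Set.Icc 0 1) =
      ∫ y, F y * transfer m N σ u y ∂(volume : Measure ℝ).restrict (Set.Icc 0 1) := by
  have hbr : ∀ k : ℕ, BoundedMeasurable fun t => u ((t + k) / m) := fun k =>
    hu.comp ((measurable_id.add_const (k : ℝ)).div_const (m : ℝ))
  rw [integral_eq_sum_integral_div
    ((hF.comp (measurable_intervalExchange_comp_stretchFold m N σ)).mul hu) hm]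
  simp_rw [transfer, mul_div_assoc', Finset.mul_sum]
  rw [integral_div, integral_finsetSum, Finset.sum_div]
  · refine Finset.sum_congr rfl fun k _ => ?_
    congr 1
    rw [← integral_comp_intervalExchange_mul hN σ hF (hbr k)]
    refine integral_congr_ae ?_
    filter_upwards [ae_mem_Ico] with t ht
    rw [Function.comp_apply, stretchFold_add_div hm k ht]
  · intro k _
    exact (hF.mul ((hbr k).comp (measurable_intervalExchange N σ⁻¹))).integrable

theorem BoundedMeasurable.iterate_transfer {m N : ℕ} (σ : Equiv.Perm (Fin N)) {u : ℝ → ℝ}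
    (hu : BoundedMeasurable u) (n : ℕ) : BoundedMeasurable ((_root_.transfer m N σ)^[n] u) := by
  induction n with
  | zero => exact hu
  | succ n ih => rw [Function.iterate_succ_apply']; exact ih.transfer σ

theorem integral_comp_iterate_mul_eq {m N : ℕ} (hm : 0 < m) (hN : 0 < N)
    (σ : Equiv.Perm (Fin N)) {F u : ℝ → ℝ} (hF : BoundedMeasurable F) (hu : BoundedMeasurable u)
    (n : ℕ) :
    ∫ x, F ((intervalExchange N σ ∘ stretchFold m)^[n] x) * u x
        ∂(volume : Measure ℝ).restrict (Set.Icc 0 1) =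
      ∫ y, F y * (transfer m N σ)^[n] u y ∂(volume : Measure ℝ).restrict (Set.Icc 0 1) := by
  induction n generalizing u with
  | zero => rfl
  | succ n ih =>
    rw [Function.iterate_succ_apply, ← ih (hu.transfer σ)]
    simp_rw [Function.iterate_succ_apply]
    exact integral_comp_mul_eq_integral_mul_transfer hm hN σ
      (hF.comp ((measurable_intervalExchange_comp_stretchFold m N σ).iterate n)) hu

theorem transfer_const {m N : ℕ} (hm : 0 < m) (σ : Equiv.Perm (Fin N)) (c : ℝ) :
    transfer m N σ (fun _ => c) = fun _ => c := by
  have hm' : (m : ℝ) ≠ 0 := by exact_mod_cast hm.ne'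
  ext y
  simp [transfer, hm']

theorem iterate_transfer_const {m N : ℕ} (hm : 0 < m) (σ : Equiv.Perm (Fin N)) (c : ℝ) (n : ℕ) :
    (transfer m N σ)^[n] (fun _ => c) = fun _ => c :=
  Function.iterate_fixed (transfer_const hm σ c) n

/-- Removing the mean of the second observable does not change the correlations. -/
theorem correlation_eq_integral_mul_iterate_transfer {m N : ℕ} (hm : 0 < m) (hN : 0 < N)
    (σ : Equiv.Perm (Fin N)) {F u : ℝ → ℝ} (hF : BoundedMeasurable F) (hu : BoundedMeasurable u)
    (n : ℕ) :
    correlation ((volume : Measure ℝ).restrict (Set.Icc 0 1))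
        (intervalExchange N σ ∘ stretchFold m) F u n =
      ∫ y, F y * (transfer m N σ)^[n]
        (fun x => u x + -(∫ z, u z ∂(volume : Measure ℝ).restrict (Set.Icc 0 1))) y
        ∂(volume : Measure ℝ).restrict (Set.Icc 0 1) := by
  set c := ∫ z, u z ∂(volume : Measure ℝ).restrict (Set.Icc 0 1)
  have hFn : BoundedMeasurable fun x => F ((intervalExchange N σ ∘ stretchFold m)^[n] x) :=
    hF.comp ((measurable_intervalExchange_comp_stretchFold m N σ).iterate n)
  have hc := BoundedMeasurable.const (-c)
  rw [← integral_comp_iterate_mul_eq hm hN σ hF (hu.add hc), correlation]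
  simp_rw [mul_add]
  rw [integral_add (hFn.mul hu).integrable (hFn.mul hc).integrable,
    integral_comp_iterate_mul_eq hm hN σ hF hc, iterate_transfer_const hm, integral_mul_const]
  ring

theorem integral_iterate_transfer {m N : ℕ} (hm : 0 < m) (hN : 0 < N)
    (σ : Equiv.Perm (Fin N)) {u : ℝ → ℝ} (hu : BoundedMeasurable u) (n : ℕ) :
    ∫ y, (transfer m N σ)^[n] u y ∂(volume : Measure ℝ).restrict (Set.Icc 0 1) =
      ∫ y, u y ∂(volume : Measure ℝ).restrict (Set.Icc 0 1) := by
  simpa using (integral_comp_iterate_mul_eq hm hN σ (BoundedMeasurable.const 1) hu n).symm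

theorem abs_integral_le_of_forall_mem_Ico {u : ℝ → ℝ} {C : ℝ}
    (hu : ∀ x ∈ Set.Ico (0 : ℝ) 1, |u x| ≤ C) :
    |∫ y, u y ∂(volume : Measure ℝ).restrict (Set.Icc 0 1)| ≤ C := by
  have h := norm_integral_le_of_norm_le_const (μ := (volume : Measure ℝ).restrict (Set.Icc 0 1))
    (f := u) (C := C) (ae_mem_Ico.mono fun x hx => hu x hx)
  simpa using h

/-- For a function with integral zero, left-endpoint samples nearly sum to zero. -/
theorem abs_sum_samples_le {N : ℕ} (hN : 0 < N) {u : ℝ → ℝ} (hu : BoundedMeasurable u)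
    (h0 : ∫ y, u y ∂(volume : Measure ℝ).restrict (Set.Icc 0 1) = 0) {V : ℝ} {s : ℕ → ℝ}
    (hs : ∀ j < N, ∀ x ∈ cell N j, |u x - s j| ≤ V) :
    |∑ i ∈ Finset.range N, s i| ≤ N * V := by
  have hN' : (0 : ℝ) < N := by exact_mod_cast hN
  have hbr : ∀ k : ℕ, BoundedMeasurable fun t => u ((t + k) / N) := fun k =>
    hu.comp ((measurable_id.add_const (k : ℝ)).div_const (N : ℝ))
  rw [integral_eq_sum_integral_div hu hN, ← Finset.sum_div,
    div_eq_zero_iff, or_iff_left hN'.ne'] at h0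
  have h1 : ∀ k ∈ Finset.range N,
      |(∫ t, u ((t + k) / N) ∂(volume : Measure ℝ).restrict (Set.Icc 0 1)) - s k| ≤ V := by
    intro k hk
    have : (∫ t, u ((t + k) / N) ∂(volume : Measure ℝ).restrict (Set.Icc 0 1)) - s k =
        ∫ t, (u ((t + k) / N) - s k) ∂(volume : Measure ℝ).restrict (Set.Icc 0 1) := by
      rw [integral_sub (hbr k).integrable (integrable_const _)]
      simp
    rw [this]
    exact abs_integral_le_of_forall_mem_Ico fun t ht =>
      hs k (Finset.mem_range.1 hk) _ (add_div_mem_cell hN k ht)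
  have h2 := (Finset.abs_sum_le_sum_abs _ _).trans (Finset.sum_le_card_nsmul _ _ V h1)
  rw [Finset.sum_sub_distrib, h0, zero_sub, abs_neg] at h2
  simpa using h2

/-! ### The upper bound for observables of bounded variation -/

/-- By the Jordan decomposition φ is a difference of monotone functions on [0,1]; these extend
monotonically to ℝ, hence are Borel, and the indicator keeps the result bounded. -/
theorem BoundedVariationOn.exists_boundedMeasurable_eqOn {φ : ℝ → ℝ}
    (hφ : BoundedVariationOn φ (Set.Icc 0 1)) :
    ∃ F, BoundedMeasurable F ∧ Set.EqOn F φ (Set.Icc 0 1) := by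
  obtain ⟨p, q, hp, hq, hpq⟩ := hφ.locallyBoundedVariationOn.exists_monotoneOn_sub_monotoneOn
  have hex : ∀ p : ℝ → ℝ, MonotoneOn p (Set.Icc 0 1) →
      ∃ g : ℝ → ℝ, Monotone g ∧ Set.EqOn p g (Set.Icc 0 1) := by
    intro p hp
    refine hp.exists_monotone_extension ⟨p 0, ?_⟩ ⟨p 1, ?_⟩
    · rintro _ ⟨x, hx, rfl⟩; exact hp (by simp) hx hx.1
    · rintro _ ⟨x, hx, rfl⟩; exact hp hx (by simp) hx.2
  obtain ⟨p', hp', hpe⟩ := hex p hp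
  obtain ⟨q', hq', hqe⟩ := hex q hq
  have heq : ∀ x ∈ Set.Icc (0 : ℝ) 1, p' x - q' x = φ x := fun x hx => by
    rw [← hpe hx, ← hqe hx, hpq]; rfl
  refine ⟨(Set.Icc 0 1).indicator (fun x => p' x - q' x),
    ⟨(hp'.measurable.sub hq'.measurable).indicator measurableSet_Icc,
      |p' 1 - q' 0| + |p' 0 - q' 1|, fun x => ?_⟩, fun x hx => ?_⟩
  · by_cases hx : x ∈ Set.Icc (0 : ℝ) 1
    · rw [Set.indicator_of_mem hx]
      have h1 := hp' hx.1
      have h2 := hp' hx.2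
      have h3 := hq' hx.1
      have h4 := hq' hx.2
      rw [abs_le]
      have := neg_abs_le (p' 0 - q' 1)
      have := le_abs_self (p' 1 - q' 0)
      have := abs_nonneg (p' 0 - q' 1)
      have := abs_nonneg (p' 1 - q' 0)
      constructor <;> linarith
    · rw [Set.indicator_of_notMem hx, abs_zero]; positivity
  · rw [Set.indicator_of_mem hx, heq x hx]

theorem cellVariation_add_const_ne_top {N : ℕ} {u : ℝ → ℝ} (hu : cellVariation N u ≠ ⊤) (c : ℝ) :
    cellVariation N (fun x => u x + c) ≠ ⊤ := by
  refine ne_top_of_le_ne_top hu (Finset.sum_le_sum fun i _ => ?_)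
  refine (eVariationOn_add_le _ _ _).trans_eq ?_
  rw [eVariationOn.constant_on (f := fun _ : ℝ => c)
    (Set.subsingleton_singleton.anti (by rintro _ ⟨_, _, rfl⟩; exact Set.mem_singleton _)),
    add_zero]

theorem cellVariation_ne_top {N : ℕ} {u : ℝ → ℝ} (hu : BoundedVariationOn u (Set.Icc 0 1)) :
    cellVariation N u ≠ ⊤ := by
  refine ENNReal.sum_ne_top.2 fun i hi => ?_
  exact hu.mono ((cell_subset_Ico (Finset.mem_range.1 hi)).trans Set.Ico_subset_Icc_self)

/-- Each iterate is split into its samples at left endpoints of cells, which obey the ℓ² recurrence,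
and its oscillation inside cells, which is at most V m⁻ⁿ. -/
theorem exists_forall_abs_iterate_transfer_le {m N : ℕ} (hm : 0 < m) (hN : m < N)
    (σ : Equiv.Perm (Fin N)) {u : ℝ → ℝ} (hu : BoundedMeasurable u)
    (hvar : cellVariation N u ≠ ⊤)
    (h0 : ∫ y, u y ∂(volume : Measure ℝ).restrict (Set.Icc 0 1) = 0) :
    ∃ A B : ℝ, ∀ n : ℕ, ∀ x ∈ Set.Ico (0 : ℝ) 1,
      |(transfer m N σ)^[n] u x| ≤ (A + n * B) * foldRate m N ^ n := by
  have hN0 : 0 < N := by omega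
  have hρ := foldRate_pos hm hN
  set ρ := foldRate m N
  set V := (cellVariation N u).toReal
  have hV0 : 0 ≤ V := ENNReal.toReal_nonneg
  set H : ℕ → ℝ → ℝ := fun n => (transfer m N σ)^[n] u with hH
  set s : ℕ → ℕ → ℝ := fun n j => H n ((j : ℝ) / N) with hs
  have hosc : ∀ n, ∀ j < N, ∀ x ∈ cell N j, |H n x - s n j| ≤ V * (m : ℝ)⁻¹ ^ n := by
    intro n j hj x hx
    obtain ⟨h1, h2⟩ := cellVariation_iterate_transfer_le hm σ hvar n
    exact (abs_sub_le_cellVariation h1 hj hx (left_mem_cell hN0 j)).trans h2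
  have hrec : ∀ n, ‖euclideanVec N (s (n + 1))‖ ≤
      ρ * ‖euclideanVec N (s n)‖ + (N * (2 * V)) * (m : ℝ)⁻¹ ^ n := by
    intro n
    have := norm_euclideanVec_le hm hN σ⁻¹ (s := s n) (s' := s (n + 1)) (V := V * (m : ℝ)⁻¹ ^ n)
      (fun i => by
        simp only [hs, hH, Function.iterate_succ_apply']
        exact abs_transfer_sub_stepTransfer_le hm σ (hosc n) i (left_mem_cell hN0 i))
      (abs_sum_samples_le hN0 (hu.iterate_transfer σ n)
        ((integral_iterate_transfer hm hN0 σ hu n).trans h0) (hosc n))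
    linarith
  have hle := le_add_mul_pow_of_recurrence (e := fun n => ‖euclideanVec N (s n)‖) hρ
    (by positivity) (inv_le_foldRate hm hN) (by positivity) hrec
  refine ⟨‖euclideanVec N (s 0)‖ + V, N * (2 * V) / ρ, fun n x hx => ?_⟩
  obtain ⟨i, hi⟩ := exists_mem_cell hN0 hx
  have h1 := hosc n i i.isLt x hi
  have h2 : |s n i| ≤ ‖euclideanVec N (s n)‖ := PiLp.norm_apply_le (euclideanVec N (s n)) i
  have h3 : (m : ℝ)⁻¹ ^ n ≤ ρ ^ n :=
    pow_le_pow_left₀ (by positivity) (inv_le_foldRate hm hN) n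
  have h4 := mul_le_mul_of_nonneg_left h3 hV0
  have h5 := abs_sub_abs_le_abs_sub (H n x) (s n i)
  have h6 := hle n
  calc |H n x| ≤ (‖euclideanVec N (s 0)‖ + n * (N * (2 * V) / ρ)) * ρ ^ n + V * ρ ^ n := by
        linarith
    _ = _ := by ring

theorem correlation_congr {m N : ℕ} (hN : 0 < N) (σ : Equiv.Perm (Fin N)) {φ ψ F u : ℝ → ℝ}
    (hF : Set.EqOn F φ (Set.Icc 0 1)) (hu : Set.EqOn u ψ (Set.Icc 0 1)) :
    correlation ((volume : Measure ℝ).restrict (Set.Icc 0 1))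
        (intervalExchange N σ ∘ stretchFold m) φ ψ =
      correlation ((volume : Measure ℝ).restrict (Set.Icc 0 1))
        (intervalExchange N σ ∘ stretchFold m) F u := by
  ext n
  have h1 := setIntegral_congr_fun (μ := volume) measurableSet_Icc hF
  have h2 := setIntegral_congr_fun (μ := volume) measurableSet_Icc hu
  rw [correlation, correlation, h1, h2]
  congr 1
  refine setIntegral_congr_fun measurableSet_Icc fun x hx => ?_
  rw [hu hx, hF (iterate_intervalExchange_comp_stretchFold_mem hN σ hx n)]

theorem correlation_isBigO {m N : ℕ} (hm : 0 < m) (hN : m < N) (σ : Equiv.Perm (Fin N)) {τ : ℝ}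
    (hτ : foldRate m N < τ) {φ ψ : ℝ → ℝ} (hφ : BoundedVariationOn φ (Set.Icc 0 1))
    (hψ : BoundedVariationOn ψ (Set.Icc 0 1)) :
    correlation ((volume : Measure ℝ).restrict (Set.Icc 0 1))
      (intervalExchange N σ ∘ stretchFold m) φ ψ =O[atTop] fun n : ℕ => τ ^ n := by
  have hN0 : 0 < N := by omega
  have hρ := foldRate_pos hm hN
  obtain ⟨F, hF, hFφ⟩ := hφ.exists_boundedMeasurable_eqOn
  obtain ⟨u, hu, huψ⟩ := hψ.exists_boundedMeasurable_eqOn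
  rw [correlation_congr hN0 σ hFφ huψ]
  have hvar : cellVariation N u ≠ ⊤ := by
    refine cellVariation_ne_top ?_
    rw [BoundedVariationOn, eVariationOn.congr huψ]
    exact hψ
  set c := ∫ z, u z ∂(volume : Measure ℝ).restrict (Set.Icc 0 1)
  obtain ⟨A, B, hAB⟩ := exists_forall_abs_iterate_transfer_le hm hN σ
    (hu.add (BoundedMeasurable.const (-c))) (cellVariation_add_const_ne_top hvar (-c))
    (by rw [integral_add hu.integrable (integrable_const _)]; simp [c])
  obtain ⟨C, hC⟩ := hF.2
  have hC0 : 0 ≤ C := (abs_nonneg _).trans (hC 0)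
  have hρτ : ‖foldRate m N‖ < τ := by rwa [Real.norm_of_nonneg hρ.le]
  -- The strict inequality `hτ` absorbs the factor linear in n.
  have hO : (fun n : ℕ => C * ((A + n * B) * foldRate m N ^ n)) =O[atTop] fun n : ℕ => τ ^ n := by
    have e0 := isLittleO_pow_const_mul_const_pow_const_pow_of_norm_lt 0 hρτ
    have e1 := isLittleO_pow_const_mul_const_pow_const_pow_of_norm_lt 1 hρτ
    have := (e0.isBigO.const_mul_left (C * A)).add (e1.isBigO.const_mul_left (C * B))
    refine this.congr_left fun n => ?_
    ring
  refine IsBigO.trans (IsBigO.of_bound 1 (Eventually.of_forall fun n => ?_)) hO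
  rw [one_mul, correlation_eq_integral_mul_iterate_transfer hm hN0 σ hF hu n]
  refine (abs_integral_le_of_forall_mem_Ico fun x hx => ?_).trans (le_abs_self _)
  rw [abs_mul]
  exact mul_le_mul (hC x) (hAB n x hx) (abs_nonneg _) hC0

theorem mixingRate_le_foldRate {m N : ℕ} (hm : 0 < m) (hN : m < N) (σ : Equiv.Perm (Fin N)) :
    mixingRate (volume.restrict (Set.Icc (0 : ℝ) 1)) (intervalExchange N σ ∘ stretchFold m) ≤
      foldRate m N := by
  refine le_of_forall_gt_imp_ge_of_dense fun τ hτ => csInf_le ⟨0, fun _ h => h.1⟩ ?_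
  exact ⟨(foldRate_pos hm hN).le.trans hτ.le, fun φ ψ hφ hψ => correlation_isBigO hm hN σ hτ hφ hψ⟩

/-! ### The lower bound: a permutation attaining the rate -/

/-- The function equal to `v j` on the `j`-th cell of length `1 / N`. -/
noncomputable def cellStep (N : ℕ) (v : ℕ → ℝ) (x : ℝ) : ℝ := v ⌊N * x⌋₊

theorem cellStep_of_mem_cell {N : ℕ} (hN : 0 < N) (v : ℕ → ℝ) {j : ℕ} {x : ℝ}
    (hx : x ∈ cell N j) : cellStep N v x = v j := by
  rw [mem_cell_iff hN] at hx
  rw [cellStep, (Nat.floor_eq_iff ((Nat.cast_nonneg j).trans hx.1)).2 hx]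

theorem boundedVariationOn_cellStep (N : ℕ) (v : ℕ → ℝ) :
    BoundedVariationOn (cellStep N v) (Set.Icc 0 1) := by
  have := (Set.finite_Iic N).to_subtype
  refine ne_top_of_le_ne_top (BoundedVariationOn.of_finite v (Set.Iic N))
    (eVariationOn.comp_le_of_monotoneOn v (fun x : ℝ => ⌊N * x⌋₊) ?_ ?_)
  · intro x _ y _ hxy
    exact Nat.floor_mono (by gcongr)
  · intro x hx
    refine (Nat.floor_mono (?_ : (N : ℝ) * x ≤ N)).trans_eq (Nat.floor_natCast N)
    nlinarith [hx.2, (Nat.cast_nonneg N : (0 : ℝ) ≤ N)]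

theorem boundedMeasurable_cellStep (N : ℕ) {v : ℕ → ℝ} {C : ℝ} (hv : ∀ j, |v j| ≤ C) :
    BoundedMeasurable (cellStep N v) :=
  ⟨(measurable_from_nat (f := v)).comp
    (Nat.measurable_floor.comp (measurable_const.mul measurable_id)), C, fun _ => hv _⟩

theorem integral_mul_of_forall_mem_cell {N : ℕ} (hN : 0 < N) {F u : ℝ → ℝ}
    (hF : BoundedMeasurable F) (hu : BoundedMeasurable u) {v s : ℕ → ℝ}
    (hv : ∀ j < N, ∀ x ∈ cell N j, F x = v j) (hs : ∀ j < N, ∀ x ∈ cell N j, u x = s j) :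
    ∫ x, F x * u x ∂(volume : Measure ℝ).restrict (Set.Icc 0 1) =
      (∑ j ∈ Finset.range N, v j * s j) / N := by
  rw [integral_eq_sum_integral_div (hF.mul hu) hN, ← Finset.sum_div]
  congr 1
  refine Finset.sum_congr rfl fun j hj => ?_
  rw [integral_congr_ae (g := fun _ => v j * s j)]
  · simp
  filter_upwards [ae_mem_Ico] with t ht
  have hj := Finset.mem_range.1 hj
  have := add_div_mem_cell hN j ht
  rw [hv j hj _ this, hs j hj _ this]

/-- The action on step values of the transfer operator with the interval exchange. -/
noncomputable def permTransfer (m N : ℕ) (σ : Equiv.Perm (Fin N)) (s : ℕ → ℝ) (j : ℕ) : ℝ :=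
  if h : j < N then stepTransfer m N s (σ⁻¹ ⟨j, h⟩ : Fin N) else 0

theorem transfer_of_forall_mem_cell {m N : ℕ} (hm : 0 < m) (σ : Equiv.Perm (Fin N)) {u : ℝ → ℝ}
    {s : ℕ → ℝ} (hs : ∀ j < N, ∀ x ∈ cell N j, u x = s j) :
    ∀ j < N, ∀ x ∈ cell N j, transfer m N σ u x = permTransfer m N σ s j := by
  intro j hj x hx
  have := abs_transfer_sub_stepTransfer_le hm σ (u := u) (V := 0) (s := s)
    (fun j hj x hx => by rw [hs j hj x hx]; simp) ⟨j, hj⟩ hx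
  rw [permTransfer, dif_pos hj]
  exact sub_eq_zero.1 (abs_nonpos_iff.1 this)

/-- The hypotheses say that v is an eigenvector of the adjoint, so pairing with v turns the operator
into multiplication by z. Real and imaginary parts reduce this to the real duality
`sum_mul_stepTransfer`. -/
theorem sum_mul_permTransfer_of_eigenvector {m N : ℕ} (hm : 0 < m) (σ : Equiv.Perm (Fin N))
    {t v : ℕ → ℂ} {z : ℂ} (hper : Function.Periodic t N) (htv : ∀ i : Fin N, t i = v (σ i))
    (heig : ∀ i, (∑ l ∈ Finset.range m, t (i * m + l)) / m = z * v i) (s : ℕ → ℝ) :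
    ∑ j ∈ Finset.range N, v j * permTransfer m N σ s j =
      z * ∑ j ∈ Finset.range N, v j * s j := by
  have h1 : ∑ j ∈ Finset.range N, v j * permTransfer m N σ s j =
      ∑ i ∈ Finset.range N, t i * stepTransfer m N s i := by
    rw [← Fin.sum_univ_eq_sum_range (fun j => v j * (permTransfer m N σ s j : ℂ)),
      ← Fin.sum_univ_eq_sum_range (fun i => t i * (stepTransfer m N s i : ℂ)),
      ← Equiv.sum_comp σ]
    refine Finset.sum_congr rfl fun i _ => ?_
    simp [permTransfer, htv]
  have h2 : ∑ i ∈ Finset.range N, t i * (stepTransfer m N s i : ℂ) =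
      ∑ i ∈ Finset.range N, ((∑ l ∈ Finset.range m, t (i * m + l)) / m) * (s i : ℂ) := by
    have hre := sum_mul_stepTransfer hm s (N := N) (t := fun i => (t i).re)
      (fun i => congrArg Complex.re (hper i))
    have him := sum_mul_stepTransfer hm s (N := N) (t := fun i => (t i).im)
      (fun i => congrArg Complex.im (hper i))
    apply Complex.ext
    · simpa [Complex.re_sum, Complex.div_natCast_re] using hre
    · simpa [Complex.im_sum, Complex.div_natCast_im] using him
  rw [h1, h2, Finset.mul_sum]
  exact Finset.sum_congr rfl fun i _ => by rw [heig]; ring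

theorem exists_perm_mul_modEq_div {d m n : ℕ} (hn : 0 < n) (hco : m.Coprime n) :
    ∃ σ : Equiv.Perm (Fin (d * n)), ∀ i, m * (σ i : ℕ) ≡ (i : ℕ) / d [MOD n] := by
  have hlt : ∀ j : Fin (d * n), (j : ℕ) / n < d := fun j => by
    rw [Nat.div_lt_iff_lt_mul hn]; exact j.isLt
  -- This is the inverse of the wanted permutation: j goes to the block of length d with index mj
  -- mod n, and ⌊j/n⌋ < d, which separates indices congruent mod n, fixes the place inside the
  -- block.
  let p : Fin (d * n) → Fin (d * n) := fun j =>
    ⟨d * (m * j % n) + j / n, by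
      have h1 := hlt j
      have h2 := Nat.mod_lt (m * j) hn
      calc d * (m * j % n) + j / n < d * (m * j % n) + d := by omega
        _ = d * (m * j % n + 1) := by ring
        _ ≤ d * n := Nat.mul_le_mul_left d h2⟩
  have hdiv : ∀ j, (p j : ℕ) / d = m * j % n := fun j => by
    have hd := (Nat.zero_le _).trans_lt (hlt j)
    show (d * (m * j % n) + j / n) / d = _
    rw [Nat.mul_add_div hd, Nat.div_eq_of_lt (hlt j), add_zero]
  have hinj : Function.Injective p := by
    intro j j' h
    have h1 : m * (j : ℕ) ≡ m * j' [MOD n] := by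
      have := congrArg (fun x : Fin (d * n) => (x : ℕ) / d) h
      simp only [hdiv] at this
      exact this
    have h2 : (j : ℕ) % n = j' % n := Nat.ModEq.cancel_left_of_coprime hco.symm h1
    have h3 : d * (m * j % n) + (j : ℕ) / n = d * (m * j' % n) + j' / n := congrArg Fin.val h
    rw [show m * (j : ℕ) % n = m * j' % n from h1] at h3
    apply Fin.ext
    rw [← Nat.div_add_mod (j : ℕ) n, ← Nat.div_add_mod (j' : ℕ) n, h2, Nat.add_left_cancel h3]
  let e := Equiv.ofBijective p (Finite.injective_iff_bijective.1 hinj)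
  refine ⟨e.symm, fun i => ?_⟩
  have h1 := hdiv (e.symm i)
  rw [show p (e.symm i) = i from e.apply_symm_apply i] at h1
  rw [h1]
  exact (Nat.mod_modEq _ _).symm

theorem le_of_pow_isBigO_pow {ρ τ : ℝ} (hρ : 0 < ρ) (hτ : 0 ≤ τ)
    (h : (fun n : ℕ => ρ ^ n) =O[atTop] fun n : ℕ => τ ^ n) : ρ ≤ τ := by
  by_contra! hlt
  refine isLittleO_irrefl ?_ (h.trans_isLittleO (isLittleO_pow_pow_of_lt_left hτ hlt))
  exact Frequently.of_forall fun n => (pow_pos hρ n).ne'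

/-- An eigenvector with sum zero of the action on step functions bounds the mixing rate below. -/
theorem norm_le_of_eigenvector {m N : ℕ} (hm : 0 < m) (hN : 0 < N) (σ : Equiv.Perm (Fin N))
    {t v : ℕ → ℂ} {z : ℂ} (hper : Function.Periodic t N) (htv : ∀ i : Fin N, t i = v (σ i))
    (heig : ∀ i, (∑ l ∈ Finset.range m, t (i * m + l)) / m = z * v i) (hz : z ≠ 0)
    (hv0 : v 0 = 1) (hv1 : ∀ j, ‖v j‖ ≤ 1) (hsum : ∑ j ∈ Finset.range N, v j = 0) {τ : ℝ}
    (hτ : 0 ≤ τ)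
    (h : ∀ φ ψ : ℝ → ℝ,
      BoundedVariationOn φ (Set.Icc 0 1) → BoundedVariationOn ψ (Set.Icc 0 1) →
      correlation (volume.restrict (Set.Icc (0 : ℝ) 1)) (intervalExchange N σ ∘ stretchFold m) φ ψ
        =O[atTop] fun n : ℕ => τ ^ n) :
    ‖z‖ ≤ τ := by
  have hN' : (0 : ℝ) < N := by exact_mod_cast hN
  -- The indicator of the first cell pairs with v to `v 0` = 1, so after n steps the pairing is
  -- exactly zⁿ.
  set s : ℕ → ℝ := fun j => if j = 0 then 1 else 0 with hs
  have hu : BoundedMeasurable (cellStep N s) :=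
    boundedMeasurable_cellStep N (C := 1) fun j => by simp only [hs]; split_ifs <;> simp
  have hstep : ∀ n, ∀ j < N, ∀ x ∈ cell N j,
      (transfer m N σ)^[n] (cellStep N s) x = (permTransfer m N σ)^[n] s j := by
    intro n
    induction n with
    | zero => exact fun j _ x hx => cellStep_of_mem_cell hN s hx
    | succ n ih =>
      simp_rw [Function.iterate_succ_apply']
      exact transfer_of_forall_mem_cell hm σ ih
  have hZ : ∀ n, ∑ j ∈ Finset.range N, v j * ((permTransfer m N σ)^[n] s j : ℝ) = z ^ n := by
    intro n
    induction n with
    | zero =>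
      rw [pow_zero, Finset.sum_eq_single_of_mem 0 (Finset.mem_range.2 hN)
        (fun j _ hj => by simp [hs, hj])]
      simp [hs, hv0]
    | succ n ih =>
      rw [Function.iterate_succ_apply', sum_mul_permTransfer_of_eigenvector hm σ hper htv heig, ih,
        pow_succ']
  have hcorr : ∀ w : ℕ → ℝ, (∀ j, |w j| ≤ 1) → ∑ j ∈ Finset.range N, w j = 0 → ∀ n,
      correlation (volume.restrict (Set.Icc (0 : ℝ) 1)) (intervalExchange N σ ∘ stretchFold m)
        (cellStep N w) (cellStep N s) n =
      (∑ j ∈ Finset.range N, w j * (permTransfer m N σ)^[n] s j) / N := by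
    intro w hw hw0 n
    have hF := boundedMeasurable_cellStep N hw
    have hcell : ∀ j < N, ∀ x ∈ cell N j, cellStep N w x = w j :=
      fun j _ x hx => cellStep_of_mem_cell hN w hx
    have hmean := integral_mul_of_forall_mem_cell hN hF (BoundedMeasurable.const 1) hcell
      (s := fun _ => 1) (fun _ _ _ _ => rfl)
    simp only [mul_one, hw0, zero_div] at hmean
    rw [correlation, hmean, zero_mul, sub_zero, integral_comp_iterate_mul_eq hm hN σ hF hu n]
    exact integral_mul_of_forall_mem_cell hN hF (hu.iterate_transfer σ n) hcell (hstep n)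
  have hre := hcorr (fun j => (v j).re) (fun j => (Complex.abs_re_le_norm _).trans (hv1 j))
    (by rw [← Complex.re_sum, hsum, Complex.zero_re])
  have him := hcorr (fun j => (v j).im) (fun j => (Complex.abs_im_le_norm _).trans (hv1 j))
    (by rw [← Complex.im_sum, hsum, Complex.zero_im])
  have hre' : ∀ n, ∑ j ∈ Finset.range N, (v j).re * (permTransfer m N σ)^[n] s j = (z ^ n).re :=
    fun n => by simp [← hZ n, Complex.re_sum]
  have him' : ∀ n, ∑ j ∈ Finset.range N, (v j).im * (permTransfer m N σ)^[n] s j = (z ^ n).im :=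
    fun n => by simp [← hZ n, Complex.im_sum]
  have hO1 := h _ _ (boundedVariationOn_cellStep N fun j => (v j).re)
    (boundedVariationOn_cellStep N s)
  have hO2 := h _ _ (boundedVariationOn_cellStep N fun j => (v j).im)
    (boundedVariationOn_cellStep N s)
  -- The real or imaginary part of zⁿ alone may be small for some n, but |z|ⁿ ≤ |Re zⁿ| + |Im zⁿ|;
  -- hence two observables are used.
  refine le_of_pow_isBigO_pow (norm_pos_iff.2 hz) hτ
    (IsBigO.trans (IsBigO.of_bound N (Eventually.of_forall fun n => ?_))
      (hO1.norm_left.add hO2.norm_left))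
  rw [hre n, him n, hre' n, him' n, ← norm_pow, norm_norm]
  simp only [Real.norm_eq_abs, abs_div, Nat.abs_cast]
  rw [← add_div, abs_div, Nat.abs_cast, mul_div_cancel₀ _ hN'.ne']
  exact (Complex.norm_le_abs_re_add_abs_im _).trans (le_abs_self _)

theorem exists_foldRate_le_mixingRate {m N : ℕ} (hm : 0 < m) (hN : m < N) :
    ∃ σ : Equiv.Perm (Fin N), foldRate m N ≤
      mixingRate (volume.restrict (Set.Icc (0 : ℝ) 1))
        (intervalExchange N σ ∘ stretchFold m) := by
  have hpi := Real.pi_pos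
  obtain ⟨d, m', n, hd, hm', hmn, hco, hmd, hNd⟩ := exists_gcd_decomposition hm hN
  have hn : 0 < n := by omega
  have hn' : (0 : ℝ) < n := by exact_mod_cast hn
  have hm1 : (1 : ℝ) ≤ m' := by exact_mod_cast hm'
  have hmn1 : (m' : ℝ) + 1 ≤ n := by exact_mod_cast hmn
  have hd' : (d : ℂ) ≠ 0 := by exact_mod_cast hd.ne'
  have hmC : (m' : ℂ) ≠ 0 := by exact_mod_cast hm'.ne'
  have hpr := Complex.isPrimitiveRoot_exp n hn.ne'
  set ω := Complex.exp (2 * Real.pi * Complex.I / n) with hω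
  have hωn : ω ^ n = 1 := hpr.pow_eq_one
  have hmod : ∀ a b : ℕ, a ≡ b [MOD n] → ω ^ a = ω ^ b := fun a b hab => by
    rw [pow_eq_pow_mod a hωn, pow_eq_pow_mod b hωn, show a % n = b % n from hab]
  set z : ℂ := (∑ k ∈ Finset.range m', ω ^ k) / m' with hz
  have hsin : 0 < Real.sin (Real.pi / n) := by
    apply Real.sin_pos_of_pos_of_lt_pi (by positivity)
    rw [div_lt_iff₀ hn']; nlinarith
  have hsinm : 0 < Real.sin (m' * (Real.pi / n)) := by
    apply Real.sin_pos_of_pos_of_lt_pi (by positivity)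
    rw [← mul_div_assoc, div_lt_iff₀ hn']; nlinarith
  have hznorm : ‖z‖ = foldRate m N := by
    have hg := norm_geom_sum_exp_mul_abs_sin (Real.pi / n) m'
    rw [show Complex.I * ((2 * (Real.pi / n) : ℝ) : ℂ) = 2 * Real.pi * Complex.I / n by
      push_cast; ring, abs_of_pos hsin, abs_of_pos hsinm] at hg
    rw [hmd, hNd, foldRate_mul_eq hd hco, hz, norm_div, Complex.norm_natCast,
      eq_div_of_mul_eq hsin.ne' hg]
  obtain ⟨σ, hσ⟩ : ∃ σ : Equiv.Perm (Fin N), ∀ i, m' * (σ i : ℕ) ≡ (i : ℕ) / d [MOD n] := by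
    rw [hNd]; exact exists_perm_mul_modEq_div hn hco
  -- Over the reals `sInf ∅ = 0`, so a lower bound requires an admissible rate; the upper bound
  -- supplies one.
  refine ⟨σ, le_csInf ⟨foldRate m N + 1, by linarith [foldRate_pos hm hN],
    fun φ ψ hφ hψ => correlation_isBigO hm hN σ (lt_add_one _) hφ hψ⟩ ?_⟩
  rintro τ ⟨hτ, h⟩
  rw [← hznorm]
  -- Since m'σ(i) ≡ ⌊i/d⌋ mod n, `t` is `v ∘ σ`. It is constant on blocks of length d, so its sum
  -- over the m indices from im is d · ω^(m'i) ∑_{k<m'} ω^k.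
  refine norm_le_of_eigenvector hm (by omega) σ (t := fun i => ω ^ (i / d))
    (v := fun j => ω ^ (m' * j)) (z := z) ?_ ?_ ?_ ?_ ?_ ?_ ?_ hτ h
  · intro i
    simp only
    rw [hNd, Nat.add_mul_div_left _ _ hd, pow_add, hωn, mul_one]
  · intro i
    exact hmod _ _ (hσ i).symm
  · intro i
    have : ∑ l ∈ Finset.range m, ω ^ ((i * m + l) / d) =
        d * ∑ k ∈ Finset.range m', ω ^ (m' * i) * ω ^ k := by
      rw [hmd, mul_comm d m', sum_range_mul_eq, Finset.mul_sum]
      refine Finset.sum_congr rfl fun k _ => ?_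
      rw [Finset.sum_congr rfl (g := fun _ => ω ^ (m' * i) * ω ^ k)]
      · simp
      intro r hr
      rw [← pow_add]
      congr 1
      rw [show i * (m' * d) + (k * d + r) = d * (m' * i + k) + r by ring, Nat.mul_add_div hd,
        Nat.div_eq_of_lt (Finset.mem_range.1 hr), add_zero]
    rw [this, ← Finset.mul_sum, hz, hmd]
    push_cast
    field_simp
  · rw [← norm_pos_iff, hznorm]; exact foldRate_pos hm hN
  · simp
  · intro j
    rw [norm_pow, hpr.norm'_eq_one hn.ne', one_pow]
  · have hne : ω ^ m' ≠ 1 := hpr.pow_ne_one_of_pos_of_lt hm'.ne' hmn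
    have hg := geom_sum_mul (ω ^ m') N
    rw [← pow_mul, hNd, show m' * (d * n) = n * (m' * d) by ring, pow_mul, hωn, one_pow,
      sub_self] at hg
    simp_rw [pow_mul]
    rw [hNd]
    exact (mul_eq_zero.1 hg).resolve_right (sub_ne_zero.2 hne)

theorem theorem1p4 (m N : ℕ) (hm : 2 ≤ m) (hN : m < N) :
    worstMixingRate N (stretchFold m) =
      ((Nat.gcd m N : ℕ) : ℝ) * Real.sin ((m : ℝ) * Real.pi / N) /
        ((m : ℝ) * Real.sin (((Nat.gcd m N : ℕ) : ℝ) * Real.pi / N)) := by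
  have hm0 : 0 < m := by omega
  apply le_antisymm
  · exact Finset.sup'_le _ _ fun σ _ => mixingRate_le_foldRate hm0 hN σ
  · obtain ⟨σ, hσ⟩ := exists_foldRate_le_mixingRate hm0 hN
    exact hσ.trans (Finset.le_sup' (fun σ => mixingRate (volume.restrict (Set.Icc (0 : ℝ) 1))
      (intervalExchange N σ ∘ stretchFold m)) (Finset.mem_univ σ))
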